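/- Let $d\ge 1$ be an integer and let $(u,v)=\int_{\mathbb R^d}u\,\overline v$ be the inner product of $L^2(\mathbb R^d)$. For a real number $k\ge 1$ and $p\in\mathbb N=\{0,1,2,\dots\}$ put $$\|u\|_{\widehat H^p_k}^2=\sum_{[a]\le p}\ \sum_{q=0}^{p-[a]}k^{-2[a]}\,\big\||x|^q\partial^a u\big\|_{L^2(\mathbb R^d)}^2 ,$$ where $a\in\mathbb N^d$, $[a]=a_1+\dots+a_d$, $\partial^a$ is the distributional derivative (and the norm is $\infty$ if some $\partial^a u$, $[a]\le p$, or some $|x|^q\partial^a u$ is not in $L^2$), and let $\widehat H^p(\mathbb R^d)\subset L^2(\mathbb R^d)$ be the closure of the Schwartz space for this norm. For $m,n\in\mathbb Z^d$ let $x_m=\sqrt{\pi/k}\,m$, $\xi_n=\sqrt{\pi/k}\,n$ and $$\Psi_{k,m,n}(x)=\Big(\frac k\pi\Big)^{d/4}e^{-\frac k2|x-x_m|^2}e^{ik(x-x_m)\cdot\xi_n}.$$ For every $k\ge1$, the frame operator $F_ku=\sum_{(m,n)\in\mathbb Z^{2d}}(u,\Psi_{k,m,n})\Psi_{k,m,n}$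 is well defined on $L^2(\mathbb R^d)$ (the series converges unconditionally for every $u$) and is a bijection of $L^2(\mathbb R^d)$. Let $\Psi^\star_{k,m,n}=F_k^{-1}\Psi_{k,m,n}$ be the dual frame and, for $D>0$, let $$\Pi_Du=\sum_{|(x_m,\xi_n)|\le D}(u,\Psi^\star_{k,m,n})\,\Psi_{k,m,n},$$ where $|\cdot|$ is the Euclidean norm of $\mathbb R^{2d}$. **Sharp estimate.** For all $d\ge1$ and $p,r\in\mathbb N$ there are constants $C>0$ and $D_\star>0$, depending only on $d$, $p$ and $r$, such that for all $k\ge1$ and all $D\ge D_\star$ the following holds. The single coherent state $u=\Psi_{k,m,0}$ with $m=(2\lceil k^{1/2}D\rceil,0,\dots,0)$ is a nonzero element of $\widehat H^{p+r}(\mathbb R^d)$, one has $u-\Pi_Du\in\widehat H^p(\mathbb R^d)$, and $$\|u-\Pi_Du\|_{\widehat H^p_k}\ \ge\ C\,D^{-r}\,\|u\|_{\widehat H^{p+r}_k}.$$ Hence the rate $D^{-r}$ cannot be improved: if a real number $\varepsilon$ satisfies $\|v-\Pi_Dv\|_{\widehat H^p_k}\le\varepsilon\,\|v\|_{\widehat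 H^{p+r}_k}$ for all $v\in\widehat H^{p+r}(\mathbb R^d)$, then $\varepsilon\ge C\,D^{-r}$. -/

import Mathlib

open MeasureTheory
open scoped SchwartzMap LineDeriv ENNReal

noncomputable section

namespace GaborApprox

/-- The space `ℝ^d` with its Euclidean norm. -/
abbrev Space (d : ℕ) : Type := EuclideanSpace ℝ (Fin d)

/-- The space `L²(ℝ^d)` of complex-valued square integrable functions. -/
abbrev L2 (d : ℕ) : Type := Lp ℂ 2 (volume : Measure (Space d))

/-! ### Weighted Sobolev spaces -/

/-- The partial derivative `∂^a = ∂₁^{a₁} ⋯ ∂_d^{a_d}` of a tempered distribution. -/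
def distribDeriv {d : ℕ} (a : Fin d → ℕ) (T : 𝓢'(Space d, ℂ)) : 𝓢'(Space d, ℂ) :=
  (List.finRange d).foldr
    (fun i S => (fun R : 𝓢'(Space d, ℂ) => ∂_{EuclideanSpace.single i (1 : ℝ)} R)^[a i] S) T

/-- `v = ∂^a u` in the sense of distributions, where `u` and `v` are in `L²(ℝ^d)`. -/
def IsDistribDeriv {d : ℕ} (a : Fin d → ℕ) (u v : L2 d) : Prop :=
  distribDeriv a (u : 𝓢'(Space d, ℂ)) = (v : 𝓢'(Space d, ℂ))

/-- The quantity `‖ |x|^q ∂^a u ‖_{L²(ℝ^d)}` in `[0, ∞]`. The distributional derivative is unique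
when it exists in `L²(ℝ^d)`, so that the infimum has one term; it is `∞` if there is none. -/
def weightedNorm {d : ℕ} (q : ℕ) (a : Fin d → ℕ) (u : L2 d) : ℝ≥0∞ :=
  ⨅ (v : L2 d) (_ : IsDistribDeriv a u v),
    eLpNorm (fun x : Space d => ((‖x‖ ^ q : ℝ) : ℂ) * v x) 2 volume

/-- The multi-indices `a ∈ ℕ^d` with `[a] = a₁ + ⋯ + a_d ≤ p`. -/
def multiIndices (d p : ℕ) : Finset (Fin d → ℕ) :=
  (Fintype.piFinset fun _ : Fin d => Finset.range (p + 1)).filter fun a => ∑ i, a i ≤ p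

/-- The square of the weighted Sobolev norm, with values in `[0, ∞]`:
`∑_{[a] ≤ p} ∑_{q = 0}^{p - [a]} k^{-2[a]} ‖ |x|^q ∂^a u ‖²`. -/
def hatNormSq {d : ℕ} (p : ℕ) (k : ℝ) (u : L2 d) : ℝ≥0∞ :=
  ∑ a ∈ multiIndices d p, ∑ q ∈ Finset.range (p - ∑ i, a i + 1),
    ENNReal.ofReal ((k ^ (2 * ∑ i, a i))⁻¹) * weightedNorm q a u ^ 2

/-- The weighted Sobolev norm `‖u‖_{Ĥ^p_k}` as a real number (meaningful for `u ∈ Ĥ^p`). -/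
def hatNorm {d : ℕ} (p : ℕ) (k : ℝ) (u : L2 d) : ℝ :=
  Real.sqrt (hatNormSq p k u).toReal

/-- The space `Ĥ^p(ℝ^d)`: the closure in `L²(ℝ^d)` of the Schwartz space with respect to the
norm `‖·‖_{Ĥ^p_k}`. -/
def HatSobolev (d p : ℕ) (k : ℝ) : Set (L2 d) :=
  {u | ∃ φ : ℕ → 𝓢(Space d, ℂ),
    Filter.Tendsto (fun j => hatNormSq p k (u - (φ j).toLp 2 volume)) Filter.atTop (nhds 0)}

/-! ### The Gabor frame -/

/-- Pairs `[m, n] ∈ ℤ^{2d}`. -/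
abbrev Lattice (d : ℕ) : Type := (Fin d → ℤ) × (Fin d → ℤ)

/-- The point `√(π/k) m` of `ℝ^d`, for `m ∈ ℤ^d`. -/
def latticePoint {d : ℕ} (k : ℝ) (m : Fin d → ℤ) : Space d :=
  WithLp.toLp 2 fun i => Real.sqrt (Real.pi / k) * (m i : ℝ)

/-- The Gaussian state
`(k/π)^{d/4} exp(-(k/2) |x - x_m|²) exp(i k (x - x_m) · ξ_n)`, with `x_m = √(π/k) m` and
`ξ_n = √(π/k) n`. -/
def gaussianState {d : ℕ} (k : ℝ) (z : Lattice d) (x : Space d) : ℂ :=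
  (((k / Real.pi) ^ ((d : ℝ) / 4) * Real.exp (-(k / 2) * ‖x - latticePoint k z.1‖ ^ 2) : ℝ) : ℂ) *
    Complex.exp (Complex.I *
      ((k * inner ℝ (x - latticePoint k z.1) (latticePoint k z.2) : ℝ) : ℂ))

lemma norm_gaussianState {d : ℕ} {k : ℝ} (hk : 0 < k) (z : Lattice d) (x : Space d) :
    ‖gaussianState k z x‖ =
      (k / Real.pi) ^ ((d : ℝ) / 4) * Real.exp (-(k / 2) * ‖x - latticePoint k z.1‖ ^ 2) := by
  have h0 : 0 ≤ (k / Real.pi) ^ ((d : ℝ) / 4) *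
      Real.exp (-(k / 2) * ‖x - latticePoint k z.1‖ ^ 2) := by
    have := Real.pi_pos
    positivity
  rw [gaussianState, norm_mul, mul_comm Complex.I, Complex.norm_exp_ofReal_mul_I, mul_one,
    Complex.norm_real, Real.norm_of_nonneg h0]

lemma continuous_gaussianState {d : ℕ} (k : ℝ) (z : Lattice d) :
    Continuous (gaussianState k z) := by
  unfold gaussianState
  fun_prop

lemma memLp_gaussianState {d : ℕ} {k : ℝ} (hk : 0 < k) (z : Lattice d) :
    MemLp (gaussianState k z) 2 (volume : Measure (Space d)) := by
  rw [memLp_two_iff_integrable_sq_norm (continuous_gaussianState k z).aestronglyMeasurable]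
  have h1 : Integrable (fun x : Space d => Real.exp (-k * ‖x‖ ^ 2)) := by
    have h := GaussianFourier.integrable_cexp_neg_mul_sq_norm_add (V := Space d)
      (b := (k : ℂ)) (by simpa using hk) 0 0
    have h' := h.norm
    refine h'.congr (Filter.Eventually.of_forall fun x => ?_)
    simp only [Complex.norm_exp]
    congr 1
    simp [← Complex.ofReal_pow]
  have h2 := (h1.comp_sub_right (latticePoint k z.1)).const_mul
    (((k / Real.pi) ^ ((d : ℝ) / 4)) ^ 2)
  refine h2.congr (Filter.Eventually.of_forall fun x => ?_)
  simp only [norm_gaussianState hk, mul_pow, ← Real.exp_nat_mul]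
  congr 2
  push_cast
  ring

/-- The Gaussian state `Ψ_{k,m,n}` as an element of `L²(ℝ^d)`. -/
def gaborState {d : ℕ} {k : ℝ} (hk : 0 < k) (z : Lattice d) : L2 d :=
  (memLp_gaussianState hk z).toLp (gaussianState k z)

/-- The frame operator `T_k^* T_k`, `u ↦ ∑_{[m,n] ∈ ℤ^{2d}} (u, Ψ_{k,m,n}) Ψ_{k,m,n}`, where
`(·,·)` is linear in its first variable; Mathlib's `inner` is linear in its second one. -/
def frameOperator {d : ℕ} {k : ℝ} (hk : 0 < k) (u : L2 d) : L2 d :=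
  ∑' z : Lattice d, (inner ℂ (gaborState hk z) u : ℂ) • gaborState hk z

/-- The dual frame `Ψ^*_{k,m,n} = S_k Ψ_{k,m,n}`, where `S_k` is the inverse of the frame
operator. -/
def dualState {d : ℕ} {k : ℝ} (hk : 0 < k) (z : Lattice d) : L2 d :=
  Function.invFun (frameOperator hk) (gaborState hk z)

/-- The pairs `[m, n]` with `|(x_m, ξ_n)| ≤ D`, for the Euclidean norm of `ℝ^{2d}`. -/
def phaseBall (d : ℕ) (k D : ℝ) : Set (Lattice d) :=
  {z | Real.sqrt (‖latticePoint k z.1‖ ^ 2 + ‖latticePoint k z.2‖ ^ 2) ≤ D}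

lemma finite_phaseBall (d : ℕ) {k : ℝ} (hk : 0 < k) (D : ℝ) : (phaseBall d k D).Finite := by
  have hs : 0 < Real.sqrt (Real.pi / k) := Real.sqrt_pos.2 (div_pos Real.pi_pos hk)
  set N : ℤ := ⌈D / Real.sqrt (Real.pi / k)⌉ with hN
  have key : ∀ (m : Fin d → ℤ), ‖latticePoint k m‖ ≤ D →
      m ∈ Set.pi Set.univ fun _ : Fin d => Set.Icc (-N) N := by
    intro m hm i _
    have h1 : ‖(latticePoint k m) i‖ ≤ D := (PiLp.norm_apply_le (latticePoint k m) i).trans hm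
    have h2 : Real.sqrt (Real.pi / k) * |(m i : ℝ)| ≤ D := by
      simpa [latticePoint, abs_mul, abs_of_pos hs] using h1
    have h3 : |(m i : ℝ)| ≤ N := by
      refine le_trans ?_ (Int.le_ceil _)
      rw [le_div_iff₀ hs]
      linarith
    have h4 : |m i| ≤ N := by exact_mod_cast h3
    exact abs_le.1 h4
  have hfin : (Set.pi Set.univ fun _ : Fin d => Set.Icc (-N) N).Finite :=
    Set.Finite.pi fun _ => Set.finite_Icc _ _
  refine (hfin.prod hfin).subset fun z hz => ?_
  have hz' : Real.sqrt (‖latticePoint k z.1‖ ^ 2 + ‖latticePoint k z.2‖ ^ 2) ≤ D := hz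
  constructor
  · exact key z.1 ((Real.le_sqrt_of_sq_le (by nlinarith [sq_nonneg ‖latticePoint k z.2‖])).trans hz')
  · exact key z.2 ((Real.le_sqrt_of_sq_le (by nlinarith [sq_nonneg ‖latticePoint k z.1‖])).trans hz')

/-- The operator `Π_D u = ∑_{|(x_m, ξ_n)| ≤ D} (u, Ψ^*_{k,m,n}) Ψ_{k,m,n}`. -/
def gaborProj {d : ℕ} {k : ℝ} (hk : 0 < k) (D : ℝ) (u : L2 d) : L2 d :=
  ∑ z ∈ (finite_phaseBall d hk D).toFinset, (inner ℂ (dualState hk z) u : ℂ) • gaborState hk z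

/-- The pair `[m, n]` with `m = (2⌈k^{1/2} D⌉, 0, …, 0)` and `n = 0`. -/
def farIndex {d : ℕ} (hd : 0 < d) (k D : ℝ) : Lattice d :=
  (Pi.single (⟨0, hd⟩ : Fin d) (2 * ⌈Real.sqrt k * D⌉), 0)

end GaborApprox

end

/-! The obstruction is localization. The state `u` is a Gaussian of width `k^{-1/2}` centred at
distance between `7D/2` and `8D` from the origin, whereas `Π_D u` is a finite sum of such Gaussians
centred in the ball of radius `D`. On `|x| ≥ 3D` the state `u` keeps L² norm at least `1/2`. With `τ
= √k D`, the projection has L² norm there at most `(180 τ²)^d exp(-τ²)`, which is below `1/4` for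
large `τ`. The error thus has norm at least `1/4` in a region where the weight `|x|^p` is at least
`(3D)^p`, so its `Ĥ^p_k` norm is at least `(3D)^p / 4`. On the other hand `u` has `Ĥ^{p+r}_k` norm
at most `K (8D)^{p+r}`, and the quotient is of order `D^{-r}`.

The tail of `Π_D u` is controlled by three facts: the number of terms is polynomial in `τ`
(`card_phaseBall_le`), each Gaussian has a tail (`eLpNorm_gaussianState_restrict_sq_le`), and the
dual states are bounded uniformly in `k` (`norm_dualState_le`). The last one needs a lower frame
bound independent of `k`, and is where most of the work lies. Scaling by `√(π/k)` removes `k`,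
tensor products reduce to dimension one, and Parseval turns the frame sum into norms of
2-periodizations of `f` times a Gaussian. In these the unshifted term dominates
(`le_tsum_lintegral_tsum_localized`). -/

open MeasureTheory
open scoped SchwartzMap LineDeriv ENNReal

noncomputable section

namespace GaborApprox

/-! ### Frames in an abstract Hilbert space -/

section HilbertFrame

variable {ι H : Type*} [NormedAddCommGroup H] [InnerProductSpace ℂ H]

/-- The inequalities `A ‖u‖² ≤ ∑ |⟪Φ i, u⟫|² ≤ B ‖u‖²` defining a frame of a Hilbert space. -/
structure IsFrame (A B : ℝ) (Φ : ι → H) : Prop where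
  pos : 0 < A
  summable_sq (u : H) : Summable fun i => ‖(inner ℂ (Φ i) u : ℂ)‖ ^ 2
  lower (u : H) : A * ‖u‖ ^ 2 ≤ ∑' i, ‖(inner ℂ (Φ i) u : ℂ)‖ ^ 2
  upper (u : H) : ∑' i, ‖(inner ℂ (Φ i) u : ℂ)‖ ^ 2 ≤ B * ‖u‖ ^ 2

variable {A B : ℝ} {Φ : ι → H}

/-- The analysis operator `u ↦ (⟪Φ i, u⟫)_i` of a frame. -/
def IsFrame.analysis (h : IsFrame A B Φ) : H →L[ℂ] lp (fun _ : ι => ℂ) 2 :=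
  LinearMap.mkContinuous
    { toFun := fun u => ⟨fun i => inner ℂ (Φ i) u, by
        refine memℓp_gen ?_
        simpa using h.summable_sq u⟩
      map_add' := fun u v => by
        ext i
        exact inner_add_right _ _ _
      map_smul' := fun c u => by
        ext i
        exact inner_smul_right _ _ _ }
    (Real.sqrt B) fun u => by
      have hn : ‖(⟨fun i => inner ℂ (Φ i) u, by
          refine memℓp_gen ?_
          simpa using h.summable_sq u⟩ : lp (fun _ : ι => ℂ) 2)‖ ^ 2 =
          ∑' i, ‖(inner ℂ (Φ i) u : ℂ)‖ ^ 2 := by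
        have := lp.norm_rpow_eq_tsum (p := 2) (by norm_num)
          (⟨fun i => inner ℂ (Φ i) u, by
            refine memℓp_gen ?_
            simpa using h.summable_sq u⟩ : lp (fun _ : ι => ℂ) 2)
        simpa using this
      refine Real.le_sqrt_of_sq_le ?_ |>.trans_eq ?_ (b := Real.sqrt (B * ‖u‖ ^ 2))
      · exact hn.le.trans (h.upper u)
      · rw [Real.sqrt_mul' _ (sq_nonneg _), Real.sqrt_sq (norm_nonneg _)]

lemma IsFrame.analysis_apply (h : IsFrame A B Φ) (u : H) (i : ι) :
    h.analysis u i = inner ℂ (Φ i) u := rfl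

variable [CompleteSpace H]

/-- The analysis sequence expands unconditionally in the standard basis of `ℓ²`, and the continuous
adjoint maps that basis to the vectors `Φ i`. -/
lemma IsFrame.hasSum (h : IsFrame A B Φ) (u : H) :
    HasSum (fun i => (inner ℂ (Φ i) u : ℂ) • Φ i) (h.analysis.adjoint (h.analysis u)) := by
  classical
  have hs := (lp.hasSum_single (p := 2) (by norm_num) (h.analysis u)).mapL h.analysis.adjoint
  refine hs.congr_fun fun i => ?_
  refine ext_inner_right ℂ fun v => ?_
  rw [ContinuousLinearMap.adjoint_inner_left, lp.inner_single_left]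
  simp [IsFrame.analysis_apply, inner_smul_left]
  ring

lemma IsFrame.inner_adjoint_analysis (h : IsFrame A B Φ) (u : H) :
    (inner ℂ (h.analysis.adjoint (h.analysis u)) u : ℂ) =
      ((∑' i, ‖(inner ℂ (Φ i) u : ℂ)‖ ^ 2 : ℝ) : ℂ) := by
  rw [ContinuousLinearMap.adjoint_inner_left, inner_self_eq_norm_sq_to_K]
  have := lp.norm_rpow_eq_tsum (p := 2) (by norm_num) (h.analysis u)
  simp only [ENNReal.toReal_ofNat, Real.rpow_ofNat, IsFrame.analysis_apply] at this
  rw [← this]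
  norm_cast

/-- The lower frame bound makes the frame operator coercive, hence invertible. -/
lemma IsFrame.bijective (h : IsFrame A B Φ) :
    Function.Bijective fun u : H => ∑' i, (inner ℂ (Φ i) u : ℂ) • Φ i := by
  have h1 : IsUnit (h.analysis.adjoint ∘L h.analysis) := by
    refine ContinuousLinearMap.isUnit_of_forall_le_norm_inner_map _ (c := ⟨A, h.pos.le⟩) h.pos ?_
    intro u
    rw [ContinuousLinearMap.comp_apply, h.inner_adjoint_analysis, Complex.norm_real]
    refine le_trans ?_ (Real.le_norm_self _)
    refine le_trans (le_of_eq ?_) (h.lower u)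
    exact mul_comm _ _
  rw [ContinuousLinearMap.isUnit_iff_bijective] at h1
  convert h1 using 1
  ext u
  exact (h.hasSum u).tsum_eq

/-- Cauchy–Schwarz applied to the quadratic form of the frame operator. This quantitative
injectivity later bounds the dual states. -/
lemma IsFrame.norm_le (h : IsFrame A B Φ) (u : H) :
    A * ‖u‖ ≤ ‖∑' i, (inner ℂ (Φ i) u : ℂ) • Φ i‖ := by
  rcases eq_or_ne u 0 with rfl | hu
  · simp
  have hu' : 0 < ‖u‖ := norm_pos_iff.2 hu
  refine le_of_mul_le_mul_right ?_ hu'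
  calc A * ‖u‖ * ‖u‖ = A * ‖u‖ ^ 2 := by ring
    _ ≤ ∑' i, ‖(inner ℂ (Φ i) u : ℂ)‖ ^ 2 := h.lower u
    _ ≤ ‖(inner ℂ (h.analysis.adjoint (h.analysis u)) u : ℂ)‖ := by
      rw [h.inner_adjoint_analysis, Complex.norm_real]
      exact Real.le_norm_self _
    _ ≤ _ := by
      rw [(h.hasSum u).tsum_eq]
      exact norm_inner_le_norm _ _

end HilbertFrame

/-! ### Weighted Cauchy–Schwarz and geometric sums over the integers -/

section Sums

lemma sq_tsum_mul_le {ι : Type*} (W c : ι → ℝ≥0∞) :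
    (∑' i, W i * c i) ^ 2 ≤ (∑' i, W i) * ∑' i, W i * c i ^ 2 := by
  have key : ∀ s : Finset ι, (∑ i ∈ s, W i * c i) ^ 2 ≤ (∑' i, W i) * ∑' i, W i * c i ^ 2 := by
    intro s
    have h := ENNReal.inner_le_weight_mul_Lp_of_nonneg s (p := 2) (by norm_num) W c
    refine (pow_le_pow_left₀ (zero_le) h 2).trans ?_
    rw [mul_pow, ← ENNReal.rpow_natCast, ← ENNReal.rpow_natCast, ← ENNReal.rpow_mul,
      ← ENNReal.rpow_mul]
    norm_num
    exact mul_le_mul' (ENNReal.sum_le_tsum s) (ENNReal.sum_le_tsum s)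
  rw [ENNReal.tsum_eq_iSup_sum, ENNReal.iSup_pow]
  exact iSup_le key

lemma tsum_geometric_natAbs (q : ℝ≥0∞) :
    ∑' l : ℤ, (if l = 0 then 0 else q ^ l.natAbs) = 2 * (q * (1 - q)⁻¹) := by
  rw [tsum_of_nat_of_neg_add_one ENNReal.summable ENNReal.summable,
    tsum_eq_zero_add' ENNReal.summable]
  have h1 : ∀ n : ℕ,
      (if ((n + 1 : ℕ) : ℤ) = 0 then 0 else q ^ ((n + 1 : ℕ) : ℤ).natAbs) = q * q ^ n := by
    intro n
    rw [if_neg (by omega), Int.natAbs_natCast, pow_succ']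
  have h2 : ∀ n : ℕ,
      (if -((n : ℤ) + 1) = 0 then 0 else q ^ (-((n : ℤ) + 1)).natAbs) = q * q ^ n := by
    intro n
    rw [if_neg (by omega), ← pow_succ']
    congr 1
  simp only [h1, h2, ENNReal.tsum_mul_left, ENNReal.tsum_geometric]
  simp [two_mul]

end Sums

/-! ### Periodization and Parseval's identity -/

section Periodization

open Set

lemma iUnion_Ioc_add_intCast_mul {T : ℝ} (hT : 0 < T) (a : ℝ) :
    ⋃ l : ℤ, Ioc (a + T * l) (a + T * l + T) = univ := by
  rw [← iUnion_Ioc_add_zsmul hT a]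
  refine iUnion_congr fun l => ?_
  simp only [zsmul_eq_mul]
  push_cast
  ring_nf

lemma pairwise_disjoint_Ioc_add_intCast_mul {T : ℝ} (a : ℝ) :
    Pairwise (Function.onFun Disjoint fun l : ℤ => Ioc (a + T * l) (a + T * l + T)) := by
  have h : (fun l : ℤ => Ioc (a + T * l) (a + T * l + T)) =
      fun n : ℤ => Ioc (a + n • T) (a + (n + 1) • T) := by
    funext l
    simp only [zsmul_eq_mul]
    push_cast
    ring_nf
  rw [h]
  exact pairwise_disjoint_Ioc_add_zsmul a T

lemma tsum_lintegral_Ioc {T : ℝ} (hT : 0 < T) (a : ℝ) (g : ℝ → ℝ≥0∞) :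
    ∑' l : ℤ, ∫⁻ y in Ioc (a + T * l) (a + T * l + T), g y = ∫⁻ y, g y := by
  rw [← lintegral_iUnion (fun _ => measurableSet_Ioc) (pairwise_disjoint_Ioc_add_intCast_mul a),
    iUnion_Ioc_add_intCast_mul hT, Measure.restrict_univ]

lemma lintegral_Ioc_add_right (a b c : ℝ) (g : ℝ → ℝ≥0∞) :
    ∫⁻ y in Ioc a b, g (y + c) = ∫⁻ y in Ioc (a + c) (b + c), g y := by
  have h := (measurePreserving_add_right volume c).setLIntegral_comp_emb
    (MeasurableEquiv.addRight c).measurableEmbedding g (Ioc a b)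
  rw [← image_add_const_Ioc]
  exact h

lemma tsum_lintegral_comp_add {T : ℝ} (hT : 0 < T) (a : ℝ) (g : ℝ → ℝ≥0∞) :
    ∑' l : ℤ, ∫⁻ y in Ioc a (a + T), g (y + T * l) = ∫⁻ y, g y := by
  rw [← tsum_lintegral_Ioc hT a]
  refine tsum_congr fun l => ?_
  rw [lintegral_Ioc_add_right]
  ring_nf

lemma integral_eq_integral_tsum {T : ℝ} (hT : 0 < T) (a : ℝ) {F : ℝ → ℂ} (hF : Integrable F) :
    ∫ y, F y = ∫ y in Ioc a (a + T), ∑' l : ℤ, F (y + T * l) := by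
  rw [integral_tsum, ← setIntegral_univ (μ := volume) (f := F),
    ← iUnion_Ioc_add_intCast_mul hT a,
    integral_iUnion (fun _ => measurableSet_Ioc) (pairwise_disjoint_Ioc_add_intCast_mul a)
      hF.integrableOn]
  · refine tsum_congr fun l => ?_
    have h := (measurePreserving_add_right volume (T * (l : ℝ))).setIntegral_image_emb
      (MeasurableEquiv.addRight (T * (l : ℝ))).measurableEmbedding F (Ioc a (a + T))
    rw [← h, image_add_const_Ioc]
    ring_nf
  · intro l
    exact (hF.comp_add_right _).aestronglyMeasurable.restrict
  · rw [tsum_lintegral_comp_add hT a fun y => ‖F y‖ₑ]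
    exact hF.2.ne

lemma ae_summable_comp_add {T : ℝ} (hT : 0 < T) (a : ℝ) {F : ℝ → ℂ} (hF : Integrable F) :
    ∀ᵐ y ∂(volume.restrict (Ioc a (a + T))), Summable fun l : ℤ => F (y + T * l) := by
  have h1 : ∫⁻ y in Ioc a (a + T), ∑' l : ℤ, ‖F (y + T * l)‖ₑ ≠ ∞ := by
    rw [lintegral_tsum, tsum_lintegral_comp_add hT a fun y => ‖F y‖ₑ]
    · exact hF.2.ne
    · intro l
      exact (hF.comp_add_right _).aestronglyMeasurable.restrict.enorm
  have h2 := ae_lt_top' (AEMeasurable.tsum fun l : ℤ =>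
      (hF.comp_add_right (T * (l : ℝ))).aestronglyMeasurable.restrict.enorm) h1
  filter_upwards [h2] with y hy
  refine Summable.of_norm ?_
  have := ENNReal.summable_toReal hy.ne
  simpa using this

/-- The characters `exp(-iπny)` are 2-periodic, so each integral over the line is twice a Fourier
coefficient of the 2-periodization. Parseval on an interval of length 2 then gives the factor `2² ·
(1/2) = 2`. -/
lemma tsum_enorm_fourier_sq {F : ℝ → ℂ} (hF : Integrable F) (a : ℝ)
    (hP : ∫⁻ y in Ioc a (a + 2), ‖∑' l : ℤ, F (y + 2 * l)‖ₑ ^ 2 ≠ ∞) :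
    ∑' n : ℤ, ‖∫ y, F y * Complex.exp (-(Complex.I * ((Real.pi * n * y : ℝ) : ℂ)))‖ₑ ^ 2 =
      2 * ∫⁻ y in Ioc a (a + 2), ‖∑' l : ℤ, F (y + 2 * l)‖ₑ ^ 2 := by
  set P : ℝ → ℂ := fun y => ∑' l : ℤ, F (y + 2 * l) with hPdef
  have hPm : AEStronglyMeasurable P (volume.restrict (Ioc a (a + 2))) :=
    AEStronglyMeasurable.tsum fun l => (hF.comp_add_right _).aestronglyMeasurable.restrict
  have hPL : MemLp P 2 (volume.restrict (Ioc a (a + 2))) := by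
    refine ⟨hPm, ?_⟩
    rw [eLpNorm_lt_top_iff_lintegral_rpow_enorm_lt_top (by norm_num) (by norm_num)]
    simpa using hP.lt_top
  have hab : a < a + 2 := by linarith
  have hE : ∀ (n : ℤ) (y : ℝ), ‖Complex.exp (-(Complex.I * ((Real.pi * n * y : ℝ) : ℂ)))‖ = 1 := by
    intro n y
    rw [← mul_neg, mul_comm, ← Complex.ofReal_neg, Complex.norm_exp_ofReal_mul_I]
  have hcoef : ∀ n : ℤ, ∫ y, F y * Complex.exp (-(Complex.I * ((Real.pi * n * y : ℝ) : ℂ))) =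
      2 * fourierCoeffOn hab P n := by
    intro n
    have hI : Integrable fun y => F y * Complex.exp (-(Complex.I * ((Real.pi * n * y : ℝ) : ℂ))) :=
      hF.mul_bdd (c := 1) (by fun_prop) (Filter.Eventually.of_forall fun y => (hE n y).le)
    rw [integral_eq_integral_tsum two_pos a hI, fourierCoeffOn_eq_integral,
      intervalIntegral.integral_of_le hab.le]
    have hT : a + 2 - a = 2 := by ring
    rw [hT]
    have : ∀ z : ℂ, (2 : ℂ) * ((1 / 2 : ℝ) • z) = z := by
      intro z
      rw [Complex.real_smul]
      push_cast
      ring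
    rw [this]
    refine integral_congr_ae (Filter.Eventually.of_forall fun y => ?_)
    simp only [hPdef, smul_eq_mul, fourier_coe_apply]
    rw [mul_comm (Complex.exp _), ← tsum_mul_right]
    refine tsum_congr fun l => ?_
    congr 1
    rw [Complex.exp_eq_exp_iff_exists_int]
    -- A shift of `y` by `2l` changes the exponent by `-2πi nl`.
    refine ⟨-(n * l), ?_⟩
    push_cast
    ring
  have hsum := hasSum_sq_fourierCoeffOn hab hPL
  simp only [hcoef, enorm_mul, mul_pow]
  rw [ENNReal.tsum_mul_left]
  have h1 : ∀ n, ‖fourierCoeffOn hab P n‖ₑ ^ 2 = ENNReal.ofReal (‖fourierCoeffOn hab P n‖ ^ 2) := by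
    intro n
    rw [ENNReal.ofReal_pow (norm_nonneg _), ofReal_norm]
  simp only [h1]
  rw [← ENNReal.ofReal_tsum_of_nonneg (fun _ => sq_nonneg _) hsum.summable, hsum.tsum_eq,
    intervalIntegral.integral_of_le hab.le, smul_eq_mul, ENNReal.ofReal_mul (by simp),
    ofReal_integral_eq_lintegral_ofReal
      ((memLp_two_iff_integrable_sq_norm hPm).1 hPL) (Filter.Eventually.of_forall fun _ => sq_nonneg _)]
  simp only [ENNReal.ofReal_pow (norm_nonneg _), ofReal_norm]
  rw [← mul_assoc]
  congr 1
  have : ‖(2 : ℂ)‖ₑ = ENNReal.ofReal 2 := by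
    rw [← ofReal_norm]
    simp
  rw [this, ← ENNReal.ofReal_pow (by norm_num), ← ENNReal.ofReal_mul (by norm_num)]
  norm_num

end Periodization

/-! ### The one-dimensional frame bounds -/

section OneDimensional

open Set

/-- The state `exp(-(π/2) (y - m)²) exp(i π (y - m) n)` of `L²(ℝ)`. -/
def unitState (z : ℤ × ℤ) (y : ℝ) : ℂ :=
  ((Real.exp (-(Real.pi / 2) * (y - z.1) ^ 2) : ℝ) : ℂ) *
    Complex.exp (Complex.I * ((Real.pi * (y - z.1) * z.2 : ℝ) : ℂ))

/-- A Schur-type estimate: weighted Cauchy–Schwarz at each point, then integration term by term.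
Both frame bounds use it with geometric weights. -/
lemma lintegral_enorm_tsum_mul_sq_le {S : Set ℝ} (hS : MeasurableSet S) {w c : ℤ → ℝ → ℂ}
    {W : ℤ → ℝ≥0∞} (hw : ∀ y ∈ S, ∀ l, ‖w l y‖ₑ ≤ W l)
    (hc : ∀ l, AEMeasurable (fun y => ‖c l y‖ₑ) (volume.restrict S)) :
    ∫⁻ y in S, ‖∑' l, c l y * w l y‖ₑ ^ 2 ≤
      (∑' l, W l) * ∑' l, W l * ∫⁻ y in S, ‖c l y‖ₑ ^ 2 := by
  calc ∫⁻ y in S, ‖∑' l, c l y * w l y‖ₑ ^ 2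
      ≤ ∫⁻ y in S, (∑' l, W l) * ∑' l, W l * ‖c l y‖ₑ ^ 2 := by
        refine setLIntegral_mono_ae' hS (Filter.Eventually.of_forall fun y hy => ?_)
        refine le_trans ?_ (sq_tsum_mul_le _ _)
        refine pow_le_pow_left₀ (zero_le) ?_ 2
        refine enorm_tsum_le_tsum_enorm.trans (ENNReal.tsum_le_tsum fun l => ?_)
        rw [enorm_mul, mul_comm]
        exact mul_le_mul_left (hw y hy l) _
    _ = _ := by
        have h1 : ∀ l, AEMeasurable (fun y => W l * ‖c l y‖ₑ ^ 2) (volume.restrict S) :=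
          fun l => ((hc l).pow_const 2).const_mul _
        rw [lintegral_const_mul'' _ (AEMeasurable.tsum h1), lintegral_tsum h1]
        congr 1
        refine tsum_congr fun l => ?_
        rw [lintegral_const_mul'' _ ((hc l).pow_const 2)]

lemma exp_sq_le_pow {κ q t s : ℝ} (hq : Real.exp (-(Real.pi / 2) * κ) ≤ q) {l : ℤ}
    (h : κ * (l.natAbs : ℝ) ≤ (t + 2 * l - s) ^ 2) :
    ‖((Real.exp (-(Real.pi / 2) * (t + 2 * l - s) ^ 2) : ℝ) : ℂ)‖ₑ ≤
      ENNReal.ofReal q ^ l.natAbs := by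
  have hq0 : 0 ≤ q := (Real.exp_pos _).le.trans hq
  rw [← ofReal_norm, Complex.norm_real, Real.norm_of_nonneg (Real.exp_pos _).le,
    ← ENNReal.ofReal_pow hq0]
  refine ENNReal.ofReal_le_ofReal ?_
  refine le_trans ?_ (pow_le_pow_left₀ (Real.exp_pos _).le hq _)
  rw [← Real.exp_nat_mul]
  refine Real.exp_le_exp.2 ?_
  nlinarith [Real.pi_pos]

/-- For `l ≠ 0`, `|t + 2l - s| ≥ 2|l| - δ ≥ (2 - δ)|l|`, and `l² ≥ |l|`. Linear growth in `|l|` is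
all that geometric decay requires; `δ = 1` serves the upper bound and `δ = 1/2` the lower one. -/
lemma natAbs_mul_le_sq {κ δ t s : ℝ} (hδ : δ ≤ 1) (hκ : κ ≤ (2 - δ) ^ 2)
    (ht : |t - s| ≤ δ) {l : ℤ} : κ * (l.natAbs : ℝ) ≤ (t + 2 * l - s) ^ 2 := by
  rcases eq_or_ne l 0 with rfl | hl
  · simpa using sq_nonneg (t - s)
  have h1 : (1 : ℝ) ≤ (l.natAbs : ℝ) := by
    exact_mod_cast Int.natAbs_pos.2 hl
  have h2 : ((l.natAbs : ℕ) : ℝ) = |(l : ℝ)| := by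
    rw [Nat.cast_natAbs, Int.cast_abs]
  rw [h2] at h1 ⊢
  have h3 : (2 - δ) * |(l : ℝ)| ≤ |t + 2 * l - s| := by
    have h4 : |2 * (l : ℝ)| - |s - t| ≤ |2 * l - (s - t)| := abs_sub_abs_le_abs_sub _ _
    rw [abs_mul, abs_two, abs_sub_comm s t] at h4
    rw [show t + 2 * (l : ℝ) - s = 2 * l - (s - t) by ring]
    nlinarith [(abs_nonneg (t - s)).trans ht]
  have hδ0 : 0 ≤ (2 - δ) * |(l : ℝ)| := by
    apply mul_nonneg <;> linarith
  have h5 : ((2 - δ) * |(l : ℝ)|) ^ 2 ≤ (t + 2 * l - s) ^ 2 := by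
    rw [← sq_abs (t + 2 * l - s)]
    exact pow_le_pow_left₀ hδ0 h3 2
  have h6 : (2 - δ) ^ 2 * |(l : ℝ)| ≤ (2 - δ) ^ 2 * |(l : ℝ)| ^ 2 :=
    mul_le_mul_of_nonneg_left (by nlinarith) (sq_nonneg _)
  nlinarith

lemma exp_neg_pi_div_two_le : Real.exp (-(Real.pi / 2) * 1) ≤ 1 / 2 := by
  have h1 : Real.exp (-(Real.pi / 2) * 1) ≤ Real.exp (-1) :=
    Real.exp_le_exp.2 (by linarith [Real.pi_gt_three])
  refine h1.trans ?_
  rw [Real.exp_neg, one_div]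
  exact inv_anti₀ two_pos (by linarith [Real.exp_one_gt_d9])

lemma exp_neg_nine_pi_div_eight_le : Real.exp (-(Real.pi / 2) * (9 / 4)) ≤ 1 / 16 := by
  have h1 : Real.exp (-(Real.pi / 2) * (9 / 4)) ≤ Real.exp (-3) :=
    Real.exp_le_exp.2 (by linarith [Real.pi_gt_three])
  refine h1.trans ?_
  rw [Real.exp_neg, one_div]
  refine inv_anti₀ (by norm_num) ?_
  have h2 : Real.exp 3 = Real.exp 1 ^ 3 := by rw [← Real.exp_nat_mul]; norm_num
  rw [h2]
  have h3 : (2.7 : ℝ) ^ 3 ≤ Real.exp 1 ^ 3 :=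
    pow_le_pow_left₀ (by norm_num) (by linarith [Real.exp_one_gt_d9]) 3
  norm_num at h3
  linarith

/-- The square is at least `exp(-π/4) ≥ 1 - π/4 > 1/5`. -/
lemma exp_neg_pi_div_eight_sq_ge {y s : ℝ} (h : |y - s| ≤ 1 / 2) :
    1 / 5 ≤ Real.exp (-(Real.pi / 2) * (y - s) ^ 2) ^ 2 := by
  rw [← Real.exp_nat_mul]
  have h1 : (y - s) ^ 2 ≤ 1 / 4 := by
    rw [← sq_abs]
    nlinarith [abs_nonneg (y - s)]
  have h2 := Real.add_one_le_exp (((2 : ℕ) : ℝ) * (-(Real.pi / 2) * (y - s) ^ 2))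
  push_cast at h2 ⊢
  nlinarith [Real.pi_lt_d2, Real.pi_pos]

lemma tsum_half_pow_natAbs : ∑' l : ℤ, (ENNReal.ofReal (1 / 2)) ^ l.natAbs = 3 := by
  have h : ∑' l : ℤ, (ENNReal.ofReal (1 / 2)) ^ l.natAbs = (ENNReal.ofReal (1 / 2)) ^ (0 : ℤ).natAbs +
      ∑' l : ℤ, (if l = 0 then 0 else (ENNReal.ofReal (1 / 2)) ^ l.natAbs) := by
    convert ENNReal.tsum_eq_add_tsum_ite (f := fun l : ℤ => (ENNReal.ofReal (1 / 2)) ^ l.natAbs) 0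
  rw [h, tsum_geometric_natAbs]
  have h1 : ENNReal.ofReal (1 / 2) = 2⁻¹ := by
    rw [one_div, ENNReal.ofReal_inv_of_pos two_pos]
    simp
  rw [h1, ENNReal.one_sub_inv_two, inv_inv, ENNReal.inv_mul_cancel (by norm_num) (by norm_num)]
  norm_num

lemma tsum_sixteenth_pow_natAbs :
    ∑' l : ℤ, (if l = 0 then 0 else (ENNReal.ofReal (1 / 16)) ^ l.natAbs) =
      ENNReal.ofReal (2 / 15) := by
  rw [tsum_geometric_natAbs, ← ENNReal.ofReal_one, ← ENNReal.ofReal_sub _ (by norm_num),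
    ← ENNReal.ofReal_inv_of_pos (by norm_num), ← ENNReal.ofReal_mul (by norm_num),
    show (2 : ℝ≥0∞) = ENNReal.ofReal 2 by simp, ← ENNReal.ofReal_mul (by norm_num)]
  norm_num

variable {f : ℝ → ℂ}

/-- The localized function `y ↦ f(y) exp(-(π/2) (y - m)²)`. -/
def localized (f : ℝ → ℂ) (m : ℤ) (y : ℝ) : ℂ :=
  f y * ((Real.exp (-(Real.pi / 2) * (y - m) ^ 2) : ℝ) : ℂ)

lemma integrable_localized (hf : MemLp f 2) (m : ℤ) : Integrable (localized f m) := by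
  refine hf.integrable_mul (q := 2) ?_
  rw [memLp_two_iff_integrable_sq_norm (by fun_prop)]
  have h := (integrable_exp_neg_mul_sq Real.pi_pos).comp_sub_right (m : ℝ)
  refine h.congr (Filter.Eventually.of_forall fun y => ?_)
  simp only
  rw [Complex.norm_real, Real.norm_of_nonneg (Real.exp_pos _).le, ← Real.exp_nat_mul]
  congr 1
  push_cast
  ring

lemma tsum_lintegral_Ioc_one (a : ℝ) (g : ℝ → ℝ≥0∞) :
    ∑' m : ℤ, ∫⁻ y in Ioc (m + a) (m + a + 1), g y = ∫⁻ y, g y := by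
  rw [← tsum_lintegral_Ioc one_pos a]
  refine tsum_congr fun m => ?_
  rw [one_mul, add_comm a]

/-- The windows of length 2 around the integers cover the line exactly twice. -/
lemma tsum_lintegral_Ioc_two (g : ℝ → ℝ≥0∞) :
    ∑' m : ℤ, ∫⁻ y in Ioc ((m : ℝ) - 1) (m + 1), g y = 2 * ∫⁻ y, g y := by
  have h : ∀ m : ℤ, ∫⁻ y in Ioc ((m : ℝ) - 1) (m + 1), g y =
      (∫⁻ y in Ioc ((m : ℝ) + -1) (m + -1 + 1), g y) +
        ∫⁻ y in Ioc ((m : ℝ) + 0) (m + 0 + 1), g y := by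
    intro m
    rw [← lintegral_union measurableSet_Ioc]
    · have : (m : ℝ) + -1 + 1 = m + 0 := by ring
      rw [this, Ioc_union_Ioc_eq_Ioc (by linarith) (by linarith)]
      simp [sub_eq_add_neg]
    · rw [Set.disjoint_left]
      intro y h1 h2
      have := h1.2
      have := h2.1
      linarith
  simp only [h]
  rw [ENNReal.tsum_add, tsum_lintegral_Ioc_one, tsum_lintegral_Ioc_one, two_mul]

lemma lintegral_tsum_localized_le (hf : MemLp f 2) (m : ℤ) :
    ∫⁻ y in Ioc ((m : ℝ) - 1) (m + 1), ‖∑' l : ℤ, localized f m (y + 2 * l)‖ₑ ^ 2 ≤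
      3 * ∑' l : ℤ, (ENNReal.ofReal (1 / 2)) ^ l.natAbs *
        ∫⁻ y in Ioc ((m : ℝ) - 1) (m + 1), ‖f (y + 2 * l)‖ₑ ^ 2 := by
  rw [← tsum_half_pow_natAbs]
  refine lintegral_enorm_tsum_mul_sq_le measurableSet_Ioc (fun y hy l => ?_) fun l => ?_
  · refine exp_sq_le_pow exp_neg_pi_div_two_le (natAbs_mul_le_sq le_rfl (by norm_num) ?_)
    rw [abs_le]
    constructor <;> linarith [hy.1, hy.2]
  · exact (hf.1.comp_measurePreserving (measurePreserving_add_right volume (2 * (l : ℝ)))).enorm.restrict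

/-- After the sums are exchanged, the shift by `2l` disappears by translation invariance. `K` is the
multiplicity with which the windows cover the line. -/
lemma tsum_mul_lintegral_comp_add (V : ℤ → ℝ≥0∞) (s : ℤ → Set ℝ) (K : ℝ≥0∞)
    (hs : ∀ g : ℝ → ℝ≥0∞, ∑' m : ℤ, ∫⁻ y in s m, g y = K * ∫⁻ y, g y) (g : ℝ → ℝ≥0∞) :
    ∑' m : ℤ, ∑' l : ℤ, V l * ∫⁻ y in s m, g (y + 2 * l) =
      (∑' l, V l) * (K * ∫⁻ y, g y) := by
  rw [ENNReal.tsum_comm]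
  simp only [ENNReal.tsum_mul_left, hs fun y => g (y + 2 * _)]
  rw [← ENNReal.tsum_mul_right]
  refine tsum_congr fun l => ?_
  rw [lintegral_add_right_eq_self]

lemma tsum_lintegral_tsum_localized_le (hf : MemLp f 2) :
    ∑' m : ℤ, ∫⁻ y in Ioc ((m : ℝ) - 1) (m + 1), ‖∑' l : ℤ, localized f m (y + 2 * l)‖ₑ ^ 2 ≤
      18 * ∫⁻ y, ‖f y‖ₑ ^ 2 := by
  refine (ENNReal.tsum_le_tsum fun m => lintegral_tsum_localized_le hf m).trans ?_
  rw [ENNReal.tsum_mul_left, tsum_mul_lintegral_comp_add _ _ 2 tsum_lintegral_Ioc_two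
    fun y => ‖f y‖ₑ ^ 2, tsum_half_pow_natAbs, ← mul_assoc, ← mul_assoc]
  norm_num

lemma lintegral_sq_enorm_lt_top {X : Type*} [MeasurableSpace X] {μ : Measure X} {f : X → ℂ}
    (hf : MemLp f 2 μ) : ∫⁻ y, ‖f y‖ₑ ^ 2 ∂μ < ∞ := by
  have := (eLpNorm_lt_top_iff_lintegral_rpow_enorm_lt_top (by norm_num) (by norm_num)).1 hf.2
  simpa using this

/-- Diagonal dominance. On the half-size window `|y - m| ≤ 1/2` the term `l = 0` of the
periodization carries a Gaussian factor whose square is at least `1/5`, while the factors of the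
remaining terms `R` sum to at most `2/15`. These smaller windows still tile the line. -/
lemma le_tsum_lintegral_tsum_localized (hf : MemLp f 2) :
    ENNReal.ofReal (1 / 10) * ∫⁻ y, ‖f y‖ₑ ^ 2 ≤
      2 * ∑' m : ℤ, ∫⁻ y in Ioc ((m : ℝ) - 1) (m + 1),
        ‖∑' l : ℤ, localized f m (y + 2 * l)‖ₑ ^ 2 := by
  set N := ∫⁻ y, ‖f y‖ₑ ^ 2 with hN
  have hNtop : N < ∞ := lintegral_sq_enorm_lt_top hf
  set s : ℤ → Set ℝ := fun m => Ioc ((m : ℝ) + -(1 / 2)) (m + -(1 / 2) + 1) with hs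
  set P : ℤ → ℝ → ℂ := fun m y => ∑' l : ℤ, localized f m (y + 2 * l) with hP
  set W : ℤ → ℝ≥0∞ := fun l => if l = 0 then 0 else (ENNReal.ofReal (1 / 16)) ^ l.natAbs with hW
  set R : ℤ → ℝ → ℂ := fun m y => ∑' l : ℤ, f (y + 2 * l) *
    (if l = 0 then 0 else
      ((Real.exp (-(Real.pi / 2) * (y + 2 * l - m) ^ 2) : ℝ) : ℂ)) with hR
  have hsub : ∀ m : ℤ, s m ⊆ Ioc ((m : ℝ) - 1) (m + 1) := by
    intro m
    exact Ioc_subset_Ioc (by linarith) (by linarith)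
  have hloc : ∀ m : ℤ, ∀ y ∈ s m, |y - m| ≤ 1 / 2 := by
    intro m y hy
    rw [abs_le]
    constructor <;> linarith [hy.1, hy.2]
  have hRle : ∑' m, ∫⁻ y in s m, ‖R m y‖ₑ ^ 2 ≤ ENNReal.ofReal (4 / 225) * N := by
    have h1 : ∀ m, ∫⁻ y in s m, ‖R m y‖ₑ ^ 2 ≤
        (∑' l, W l) * ∑' l : ℤ, W l * ∫⁻ y in s m, ‖f (y + 2 * l)‖ₑ ^ 2 := by
      intro m
      refine lintegral_enorm_tsum_mul_sq_le measurableSet_Ioc (fun y hy l => ?_) fun l => ?_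
      · simp only [hW]
        split_ifs with h
        · simp
        · exact exp_sq_le_pow exp_neg_nine_pi_div_eight_le
            (natAbs_mul_le_sq (δ := 1 / 2) (by norm_num) (by norm_num) (hloc m y hy))
      · exact (hf.1.comp_measurePreserving
          (measurePreserving_add_right volume (2 * (l : ℝ)))).enorm.restrict
    refine (ENNReal.tsum_le_tsum h1).trans ?_
    rw [ENNReal.tsum_mul_left, tsum_mul_lintegral_comp_add W s 1
      (fun g => by rw [one_mul]; exact tsum_lintegral_Ioc_one _ g) fun y => ‖f y‖ₑ ^ 2,
      tsum_sixteenth_pow_natAbs, one_mul, ← mul_assoc, ← ENNReal.ofReal_mul (by norm_num)]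
    refine le_of_eq ?_
    congr 2
    norm_num
  have hpt : ∀ m : ℤ, ∀ᵐ y ∂(volume.restrict (s m)),
      ENNReal.ofReal (1 / 5) * ‖f y‖ₑ ^ 2 ≤ 2 * ‖P m y‖ₑ ^ 2 + 2 * ‖R m y‖ₑ ^ 2 := by
    intro m
    -- The term `l = 0` can be split off only where the series is summable, since `tsum` is `0` by
    -- default elsewhere.
    have hsum := ae_summable_comp_add two_pos ((m : ℝ) - 1) (integrable_localized hf m)
    rw [show (m : ℝ) - 1 + 2 = m + 1 by ring] at hsum
    have hsum' := ae_restrict_of_ae_restrict_of_subset (hsub m) hsum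
    filter_upwards [hsum', ae_restrict_mem measurableSet_Ioc] with y hy hys
    have h1 : P m y = localized f m y + R m y := by
      have := hy.tsum_eq_add_tsum_ite 0
      simp only [hP, hR]
      rw [this]
      congr 1
      · simp
      · refine tsum_congr fun l => ?_
        split_ifs <;> simp [localized]
    have h2 : 1 / 5 * ‖f y‖ ^ 2 ≤ ‖localized f m y‖ ^ 2 := by
      rw [localized, norm_mul, mul_pow, Complex.norm_real, Real.norm_of_nonneg (Real.exp_pos _).le,
        mul_comm]
      exact mul_le_mul_of_nonneg_left (exp_neg_pi_div_eight_sq_ge (hloc m y hys)) (sq_nonneg _)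
    have h3 : ‖localized f m y‖ ≤ ‖P m y‖ + ‖R m y‖ := by
      have : localized f m y = P m y - R m y := by rw [h1]; ring
      rw [this]
      exact norm_sub_le _ _
    have h4 : 1 / 5 * ‖f y‖ ^ 2 ≤ 2 * ‖P m y‖ ^ 2 + 2 * ‖R m y‖ ^ 2 := by
      nlinarith [norm_nonneg (localized f m y), sq_nonneg (‖P m y‖ - ‖R m y‖)]
    have h5 := ENNReal.ofReal_le_ofReal h4
    rw [ENNReal.ofReal_add (by positivity) (by positivity), ENNReal.ofReal_mul (by norm_num),
      ENNReal.ofReal_mul (by norm_num), ENNReal.ofReal_mul (by norm_num)] at h5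
    simpa [ENNReal.ofReal_pow] using h5
  have hPm : ∀ m, AEMeasurable (fun y => 2 * ‖P m y‖ₑ ^ 2) (volume.restrict (s m)) := by
    intro m
    have : AEStronglyMeasurable (P m) (volume.restrict (s m)) :=
      AEStronglyMeasurable.tsum fun l =>
        ((integrable_localized hf m).comp_add_right _).aestronglyMeasurable.restrict
    exact (this.enorm.pow_const 2).const_mul _
  -- The constant `8/225` is `2 · (2/15)²`.
  have hmain : ENNReal.ofReal (1 / 5) * N ≤
      2 * (∑' m : ℤ, ∫⁻ y in Ioc ((m : ℝ) - 1) (m + 1), ‖P m y‖ₑ ^ 2) +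
        ENNReal.ofReal (8 / 225) * N := by
    calc ENNReal.ofReal (1 / 5) * N
        = ∑' m, ∫⁻ y in s m, ENNReal.ofReal (1 / 5) * ‖f y‖ₑ ^ 2 := by
          rw [tsum_lintegral_Ioc_one, lintegral_const_mul'' _ (hf.1.enorm.pow_const 2)]
      _ ≤ ∑' m, ((2 * ∫⁻ y in s m, ‖P m y‖ₑ ^ 2) + 2 * ∫⁻ y in s m, ‖R m y‖ₑ ^ 2) := by
          refine ENNReal.tsum_le_tsum fun m => ?_
          refine (lintegral_mono_ae (hpt m)).trans ?_
          rw [lintegral_add_left' (hPm m), lintegral_const_mul' _ _ (by norm_num),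
            lintegral_const_mul' _ _ (by norm_num)]
      _ = 2 * (∑' m, ∫⁻ y in s m, ‖P m y‖ₑ ^ 2) + 2 * ∑' m, ∫⁻ y in s m, ‖R m y‖ₑ ^ 2 := by
          rw [ENNReal.tsum_add, ENNReal.tsum_mul_left, ENNReal.tsum_mul_left]
      _ ≤ _ := by
          gcongr ?_ + ?_
          · gcongr 2 * ?_
            exact ENNReal.tsum_le_tsum fun m => lintegral_mono_set (hsub m)
          · refine (mul_le_mul_right hRle 2).trans ?_
            rw [← mul_assoc, show (2 : ℝ≥0∞) = ENNReal.ofReal 2 by simp,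
              ← ENNReal.ofReal_mul (by norm_num)]
            norm_num
  -- The remainder is absorbed because `1/10 + 8/225 < 1/5`; cancelling it needs `N` to be finite.
  have hsplit : ENNReal.ofReal (1 / 10) * N + ENNReal.ofReal (8 / 225) * N ≤
      ENNReal.ofReal (1 / 5) * N := by
    rw [← add_mul, ← ENNReal.ofReal_add (by norm_num) (by norm_num)]
    gcongr
    norm_num
  exact (ENNReal.add_le_add_iff_right
    (ENNReal.mul_ne_top ENNReal.ofReal_ne_top hNtop.ne)).1 (hsplit.trans hmain)

lemma enorm_integral_mul_conj_unitState (f : ℝ → ℂ) (m n : ℤ) :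
    ‖∫ y, f y * (starRingEnd ℂ) (unitState (m, n) y)‖ₑ =
      ‖∫ y, localized f m y * Complex.exp (-(Complex.I * ((Real.pi * n * y : ℝ) : ℂ)))‖ₑ := by
  have h : ∀ y, f y * (starRingEnd ℂ) (unitState (m, n) y) =
      Complex.exp (((Real.pi * m * n : ℝ) : ℂ) * Complex.I) *
        (localized f m y * Complex.exp (-(Complex.I * ((Real.pi * n * y : ℝ) : ℂ)))) := by
    intro y
    have he : Complex.exp ((starRingEnd ℂ)
        (Complex.I * ((Real.pi * (y - (m : ℝ)) * (n : ℝ) : ℝ) : ℂ))) =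
        Complex.exp (((Real.pi * m * n : ℝ) : ℂ) * Complex.I) *
          Complex.exp (-(Complex.I * ((Real.pi * n * y : ℝ) : ℂ))) := by
      rw [← Complex.exp_add]
      congr 1
      simp only [map_mul, Complex.conj_I, Complex.conj_ofReal]
      push_cast
      ring
    rw [unitState, localized, map_mul, Complex.conj_ofReal, ← Complex.exp_conj, he]
    ring
  simp only [h]
  rw [integral_const_mul, enorm_mul]
  have : ‖Complex.exp (((Real.pi * m * n : ℝ) : ℂ) * Complex.I)‖ₑ = 1 := by
    rw [← ofReal_norm, Complex.norm_exp_ofReal_mul_I]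
    simp
  rw [this, one_mul]

/-- For fixed `m` the sum over `n` is a Parseval sum for `localized f m`, up to unimodular phases.
The upper bound already proved supplies the square integrability of the periodization. -/
lemma tsum_unitState_eq (hf : MemLp f 2) :
    ∑' z : ℤ × ℤ, ‖∫ y, f y * (starRingEnd ℂ) (unitState z y)‖ₑ ^ 2 =
      2 * ∑' m : ℤ, ∫⁻ y in Ioc ((m : ℝ) - 1) (m + 1),
        ‖∑' l : ℤ, localized f m (y + 2 * l)‖ₑ ^ 2 := by
  rw [ENNReal.tsum_prod', ← ENNReal.tsum_mul_left]
  refine tsum_congr fun m => ?_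
  simp only [enorm_integral_mul_conj_unitState]
  have h := tsum_enorm_fourier_sq (integrable_localized hf m) ((m : ℝ) - 1)
  rw [show (m : ℝ) - 1 + 2 = m + 1 by ring] at h
  refine h (ne_top_of_le_ne_top ?_ ((ENNReal.le_tsum m).trans
    (tsum_lintegral_tsum_localized_le hf)))
  exact ENNReal.mul_ne_top (by norm_num) (lintegral_sq_enorm_lt_top hf).ne

end OneDimensional

/-! ### Frame bounds under products, equivalences and dilations -/

section FrameBounds

/-- A family of square integrable functions `Φ i` with
`A ∫ |f|² ≤ ∑ |∫ f (Φ i)^*|² ≤ B ∫ |f|²` for all square integrable `f`. -/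
structure HasFrameBounds {X ι : Type*} [MeasurableSpace X] (μ : Measure X) (A B : ℝ≥0∞)
    (Φ : ι → X → ℂ) : Prop where
  memLp (i : ι) : MemLp (Φ i) 2 μ
  lower (f : X → ℂ) (hf : MemLp f 2 μ) :
    A * ∫⁻ x, ‖f x‖ₑ ^ 2 ∂μ ≤ ∑' i, ‖∫ x, f x * (starRingEnd ℂ) (Φ i x) ∂μ‖ₑ ^ 2
  upper (f : X → ℂ) (hf : MemLp f 2 μ) :
    ∑' i, ‖∫ x, f x * (starRingEnd ℂ) (Φ i x) ∂μ‖ₑ ^ 2 ≤ B * ∫⁻ x, ‖f x‖ₑ ^ 2 ∂μ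

variable {X Y ι κ : Type*} [MeasurableSpace X] [MeasurableSpace Y] {μ : Measure X} {ν : Measure Y}
  {A B A' B' : ℝ≥0∞}

lemma memLp_two_of_lintegral {f : X → ℂ} (hm : AEStronglyMeasurable f μ)
    (h : ∫⁻ x, ‖f x‖ₑ ^ 2 ∂μ < ∞) : MemLp f 2 μ := by
  refine ⟨hm, ?_⟩
  rw [eLpNorm_lt_top_iff_lintegral_rpow_enorm_lt_top (by norm_num) (by norm_num)]
  simpa using h

lemma memLp_prod_mul [SFinite μ] [SFinite ν] {φ : X → ℂ} {θ : Y → ℂ} (hφ : MemLp φ 2 μ)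
    (hθ : MemLp θ 2 ν) : MemLp (fun z : X × Y => φ z.1 * θ z.2) 2 (μ.prod ν) := by
  have hm : AEStronglyMeasurable (fun z : X × Y => φ z.1 * θ z.2) (μ.prod ν) :=
    hφ.1.comp_fst.mul hθ.1.comp_snd
  rw [memLp_two_iff_integrable_sq_norm hm]
  simp only [norm_mul, mul_pow]
  exact ((memLp_two_iff_integrable_sq_norm hφ.1).1 hφ).mul_prod
    ((memLp_two_iff_integrable_sq_norm hθ.1).1 hθ)

lemma memLp_conj {φ : X → ℂ} (hφ : MemLp φ 2 μ) :
    MemLp (fun x => (starRingEnd ℂ) (φ x)) 2 μ :=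
  hφ.of_le (Complex.continuous_conj.comp_aestronglyMeasurable hφ.1)
    (Filter.Eventually.of_forall fun x => by simp)

/-- By Fubini the coefficients of `f` are those of the partial coefficients `v j x = ∫ f(x, y)
conj(Θ j y) dy`. The bounds for `Θ` apply to almost every slice of `f`, those for `Φ` to each `v j`;
finiteness of `B'` puts `v j` in L². -/
lemma HasFrameBounds.prod [SFinite μ] [SFinite ν] {Φ : ι → X → ℂ} {Θ : κ → Y → ℂ} [Countable κ]
    (hΦ : HasFrameBounds μ A B Φ) (hΘ : HasFrameBounds ν A' B' Θ) (hB' : B' ≠ ∞) :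
    HasFrameBounds (μ.prod ν) (A * A') (B * B')
      (fun (i : ι × κ) (z : X × Y) => Φ i.1 z.1 * Θ i.2 z.2) := by
  have key : ∀ f : X × Y → ℂ, MemLp f 2 (μ.prod ν) → ∃ v : κ → X → ℂ,
      (∀ j, MemLp (v j) 2 μ) ∧
      (∀ i j, ∫ z, f z * (starRingEnd ℂ) (Φ i z.1 * Θ j z.2) ∂(μ.prod ν) =
        ∫ x, v j x * (starRingEnd ℂ) (Φ i x) ∂μ) ∧
      A' * ∫⁻ z, ‖f z‖ₑ ^ 2 ∂(μ.prod ν) ≤ ∑' j, ∫⁻ x, ‖v j x‖ₑ ^ 2 ∂μ ∧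
      ∑' j, ∫⁻ x, ‖v j x‖ₑ ^ 2 ∂μ ≤ B' * ∫⁻ z, ‖f z‖ₑ ^ 2 ∂(μ.prod ν) := by
    intro f hf
    have hN : ∫⁻ z, ‖f z‖ₑ ^ 2 ∂(μ.prod ν) < ∞ := lintegral_sq_enorm_lt_top hf
    have hfe : AEMeasurable (fun z => ‖f z‖ₑ ^ 2) (μ.prod ν) := hf.1.enorm.pow_const 2
    have hfub := lintegral_prod _ hfe
    have hslice : ∀ᵐ x ∂μ, MemLp (fun y => f (x, y)) 2 ν := by
      rw [hfub] at hN
      filter_upwards [hf.1.prodMk_left, ae_lt_top' hfe.lintegral_prod_right' hN.ne] with x h1 h2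
      exact memLp_two_of_lintegral h1 h2
    set v : κ → X → ℂ := fun j x => ∫ y, f (x, y) * (starRingEnd ℂ) (Θ j y) ∂ν with hv
    have hvm : ∀ j, AEStronglyMeasurable (v j) μ := fun j =>
      (hf.1.mul (memLp_conj (hΘ.memLp j)).1.comp_snd).integral_prod_right'
    have hve : ∀ j, AEMeasurable (fun x => ‖v j x‖ₑ ^ 2) μ := fun j => (hvm j).enorm.pow_const 2
    have hup : ∑' j, ∫⁻ x, ‖v j x‖ₑ ^ 2 ∂μ ≤ B' * ∫⁻ z, ‖f z‖ₑ ^ 2 ∂(μ.prod ν) := by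
      rw [← lintegral_tsum hve, hfub, ← lintegral_const_mul' _ _ hB']
      refine lintegral_mono_ae ?_
      filter_upwards [hslice] with x hx
      exact hΘ.upper _ hx
    refine ⟨v, fun j => memLp_two_of_lintegral (hvm j) ?_, ?_, ?_, hup⟩
    · exact ((ENNReal.le_tsum j).trans hup).trans_lt (ENNReal.mul_lt_top hB'.lt_top hN)
    · intro i j
      refine (integral_prod _ (hf.integrable_mul (memLp_conj
        (memLp_prod_mul (hΦ.memLp i) (hΘ.memLp j))))).trans ?_
      refine integral_congr_ae (Filter.Eventually.of_forall fun x => ?_)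
      simp only [hv, Pi.mul_apply]
      rw [← integral_mul_const]
      refine integral_congr_ae (Filter.Eventually.of_forall fun y => ?_)
      simp only [map_mul]
      ring
    · rw [← lintegral_tsum hve, hfub, ← lintegral_const_mul'' _ hfe.lintegral_prod_right']
      refine lintegral_mono_ae ?_
      filter_upwards [hslice] with x hx
      exact hΘ.lower _ hx
  refine ⟨fun i => memLp_prod_mul (hΦ.memLp i.1) (hΘ.memLp i.2), fun f hf => ?_, fun f hf => ?_⟩
  · obtain ⟨v, hv, hint, hlo, -⟩ := key f hf
    rw [ENNReal.tsum_prod', ENNReal.tsum_comm]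
    simp only [hint]
    calc A * A' * ∫⁻ z, ‖f z‖ₑ ^ 2 ∂(μ.prod ν)
        ≤ A * ∑' j, ∫⁻ x, ‖v j x‖ₑ ^ 2 ∂μ := by
          rw [mul_assoc]
          exact mul_le_mul_right hlo A
      _ ≤ _ := by
          rw [← ENNReal.tsum_mul_left]
          exact ENNReal.tsum_le_tsum fun j => hΦ.lower _ (hv j)
  · obtain ⟨v, hv, hint, -, hup⟩ := key f hf
    rw [ENNReal.tsum_prod', ENNReal.tsum_comm]
    simp only [hint]
    calc _ ≤ B * ∑' j, ∫⁻ x, ‖v j x‖ₑ ^ 2 ∂μ := by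
          rw [← ENNReal.tsum_mul_left]
          exact ENNReal.tsum_le_tsum fun j => hΦ.upper _ (hv j)
      _ ≤ B * B' * ∫⁻ z, ‖f z‖ₑ ^ 2 ∂(μ.prod ν) := by
          rw [mul_assoc]
          exact mul_le_mul_right hup B

lemma HasFrameBounds.comp_equiv {Φ : ι → Y → ℂ} (h : HasFrameBounds ν A B Φ) (e : X ≃ᵐ Y)
    (he : MeasurePreserving e μ ν) (σ : κ ≃ ι) :
    HasFrameBounds μ A B (fun j x => Φ (σ j) (e x)) := by
  have key : ∀ f : X → ℂ, MemLp f 2 μ → MemLp (f ∘ e.symm) 2 ν ∧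
      ∫⁻ x, ‖f x‖ₑ ^ 2 ∂μ = ∫⁻ y, ‖(f ∘ e.symm) y‖ₑ ^ 2 ∂ν ∧
      ∑' j, ‖∫ x, f x * (starRingEnd ℂ) (Φ (σ j) (e x)) ∂μ‖ₑ ^ 2 =
        ∑' i, ‖∫ y, (f ∘ e.symm) y * (starRingEnd ℂ) (Φ i y) ∂ν‖ₑ ^ 2 := by
    intro f hf
    refine ⟨hf.comp_measurePreserving (he.symm e), ?_, ?_⟩
    · rw [← he.lintegral_comp_emb e.measurableEmbedding]
      simp
    · rw [← σ.tsum_eq]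
      refine tsum_congr fun j => ?_
      rw [← he.integral_comp']
      simp
  refine ⟨fun j => (h.memLp (σ j)).comp_measurePreserving he, fun f hf => ?_, fun f hf => ?_⟩
  · obtain ⟨h1, h2, h3⟩ := key f hf
    rw [h2, h3]
    exact h.lower _ h1
  · obtain ⟨h1, h2, h3⟩ := key f hf
    rw [h2, h3]
    exact h.upper _ h1

lemma lintegral_eq_mul_lintegral_comp_smul {E : Type*} [NormedAddCommGroup E] [NormedSpace ℝ E]
    [MeasurableSpace E] [BorelSpace E] [FiniteDimensional ℝ E] {μ : Measure E}
    [μ.IsAddHaarMeasure] {s : ℝ} (hs : 0 < s) (g : E → ℝ≥0∞) :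
    ∫⁻ x, g x ∂μ = ENNReal.ofReal (s ^ Module.finrank ℝ E) * ∫⁻ y, g (s • y) ∂μ := by
  set n := Module.finrank ℝ E
  have hsn : 0 < s ^ n := pow_pos hs n
  set e : E ≃ᵐ E := (Homeomorph.smulOfNeZero s hs.ne').toMeasurableEquiv
  have h1 := lintegral_map_equiv (μ := μ) g e
  have h2 : Measure.map e μ = ENNReal.ofReal |(s ^ n)⁻¹| • μ := Measure.map_addHaar_smul μ hs.ne'
  rw [h2, lintegral_smul_measure, abs_of_pos (inv_pos.2 hsn)] at h1
  have h3 : ∫⁻ y, g (e y) ∂μ = ∫⁻ y, g (s • y) ∂μ := rfl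
  rw [← h3, ← h1, smul_eq_mul, ← mul_assoc, ← ENNReal.ofReal_mul hsn.le, mul_inv_cancel₀ hsn.ne',
    ENNReal.ofReal_one, one_mul]

/-- The condition `hc` makes the normalized dilation `Φ i ↦ Ψ i` an L² isometry, so the constants do
not change. -/
lemma HasFrameBounds.comp_smul {E : Type*} [NormedAddCommGroup E] [NormedSpace ℝ E]
    [MeasurableSpace E] [BorelSpace E] [FiniteDimensional ℝ E] {μ : Measure E}
    [μ.IsAddHaarMeasure] {Φ : ι → E → ℂ} (h : HasFrameBounds μ A B Φ) {s : ℝ} (hs : 0 < s)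
    {c : ℂ} (hc : ‖c‖ ^ 2 * s ^ Module.finrank ℝ E = 1) {Ψ : ι → E → ℂ}
    (hΨ : ∀ i y, Ψ i (s • y) = c * Φ i y) :
    HasFrameBounds μ A B Ψ := by
  set n := Module.finrank ℝ E
  have hsn : 0 < s ^ n := pow_pos hs n
  have hlint : ∀ g : E → ℝ≥0∞, ∫⁻ x, g x ∂μ = ENNReal.ofReal (s ^ n) * ∫⁻ y, g (s • y) ∂μ :=
    lintegral_eq_mul_lintegral_comp_smul hs
  have hqmp : Measure.QuasiMeasurePreserving (fun y : E => s • y) μ μ := by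
    refine ⟨measurable_const_smul s, ?_⟩
    rw [Measure.map_addHaar_smul μ hs.ne']
    exact Measure.smul_absolutelyContinuous
  have key : ∀ f : E → ℂ, MemLp f 2 μ → MemLp (fun y => f (s • y)) 2 μ ∧
      ∑' i, ‖∫ x, f x * (starRingEnd ℂ) (Ψ i x) ∂μ‖ₑ ^ 2 = ENNReal.ofReal (s ^ n) *
        ∑' i, ‖∫ y, f (s • y) * (starRingEnd ℂ) (Φ i y) ∂μ‖ₑ ^ 2 := by
    intro f hf
    constructor
    · refine memLp_two_of_lintegral (hf.1.comp_quasiMeasurePreserving hqmp) ?_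
      have := lintegral_sq_enorm_lt_top hf
      rw [hlint] at this
      exact ENNReal.lt_top_of_mul_ne_top_right this.ne (by simpa using hsn)
    · rw [← ENNReal.tsum_mul_left]
      refine tsum_congr fun i => ?_
      have h1 := Measure.integral_comp_smul μ (fun x => f x * (starRingEnd ℂ) (Ψ i x)) s
      have h2 : ∫ y, f (s • y) * (starRingEnd ℂ) (Ψ i (s • y)) ∂μ =
          (starRingEnd ℂ) c * ∫ y, f (s • y) * (starRingEnd ℂ) (Φ i y) ∂μ := by
        rw [← integral_const_mul]
        refine integral_congr_ae (Filter.Eventually.of_forall fun y => ?_)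
        simp only [hΨ, map_mul]
        ring
      rw [h2, abs_of_pos (inv_pos.2 hsn)] at h1
      have h3 : ∫ x, f x * (starRingEnd ℂ) (Ψ i x) ∂μ =
          ((s ^ n : ℝ) : ℂ) * ((starRingEnd ℂ) c * ∫ y, f (s • y) * (starRingEnd ℂ) (Φ i y) ∂μ) := by
        rw [h1, Complex.real_smul, ← mul_assoc, ← Complex.ofReal_mul, mul_inv_cancel₀ hsn.ne']
        simp
      rw [h3, enorm_mul, enorm_mul, mul_pow, mul_pow, ← mul_assoc]
      congr 1
      rw [← ofReal_norm, ← ofReal_norm, Complex.norm_real, Real.norm_of_nonneg hsn.le,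
        RCLike.norm_conj, ← ENNReal.ofReal_pow hsn.le, ← ENNReal.ofReal_pow (norm_nonneg _),
        ← ENNReal.ofReal_mul (by positivity)]
      congr 1
      calc (s ^ n) ^ 2 * ‖c‖ ^ 2 = s ^ n * (‖c‖ ^ 2 * s ^ n) := by ring
        _ = s ^ n := by rw [hc, mul_one]
  have hmem : ∀ i, MemLp (Ψ i) 2 μ := by
    intro i
    have hrep : Ψ i = fun x => c * Φ i (s⁻¹ • x) := by
      funext x
      rw [← hΨ, smul_inv_smul₀ hs.ne']
    have hqmp' : Measure.QuasiMeasurePreserving (fun y : E => s⁻¹ • y) μ μ := by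
      refine ⟨measurable_const_smul s⁻¹, ?_⟩
      rw [Measure.map_addHaar_smul μ (inv_ne_zero hs.ne')]
      exact Measure.smul_absolutelyContinuous
    have hm : AEStronglyMeasurable (Ψ i) μ := by
      rw [hrep]
      exact ((h.memLp i).1.comp_quasiMeasurePreserving hqmp').const_mul c
    refine memLp_two_of_lintegral hm ?_
    rw [hlint]
    simp only [hΨ]
    refine ENNReal.mul_lt_top ENNReal.ofReal_lt_top ?_
    exact lintegral_sq_enorm_lt_top ((h.memLp i).const_mul c)
  refine ⟨hmem, fun f hf => ?_, fun f hf => ?_⟩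
  · obtain ⟨h1, h2⟩ := key f hf
    rw [h2, hlint, mul_left_comm]
    exact mul_le_mul_right (h.lower _ h1) _
  · obtain ⟨h1, h2⟩ := key f hf
    rw [h2, hlint fun x => ‖f x‖ₑ ^ 2, mul_left_comm]
    exact mul_le_mul_right (h.upper _ h1) _

end FrameBounds

/-! ### The Gaussian frame, with bounds independent of `k` -/

section GaussianFrame

lemma memLp_unitState (z : ℤ × ℤ) : MemLp (unitState z) 2 := by
  have hm : Continuous (unitState z) := by
    unfold unitState
    fun_prop
  rw [memLp_two_iff_integrable_sq_norm hm.aestronglyMeasurable]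
  have h := (integrable_exp_neg_mul_sq Real.pi_pos).comp_sub_right (z.1 : ℝ)
  refine h.congr (Filter.Eventually.of_forall fun y => ?_)
  simp only
  rw [unitState, norm_mul, mul_comm Complex.I, Complex.norm_exp_ofReal_mul_I, mul_one,
    Complex.norm_real, Real.norm_of_nonneg (Real.exp_pos _).le, ← Real.exp_nat_mul]
  congr 1
  push_cast
  ring

lemma hasFrameBounds_unitState :
    HasFrameBounds volume (ENNReal.ofReal (1 / 10)) (ENNReal.ofReal 36) unitState := by
  refine ⟨memLp_unitState, fun f hf => ?_, fun f hf => ?_⟩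
  · rw [tsum_unitState_eq hf]
    exact le_tsum_lintegral_tsum_localized hf
  · rw [tsum_unitState_eq hf]
    refine (mul_le_mul_right (tsum_lintegral_tsum_localized_le hf) 2).trans (le_of_eq ?_)
    rw [← mul_assoc]
    norm_num

lemma hasFrameBounds_prod_unitState (d : ℕ) :
    HasFrameBounds volume (ENNReal.ofReal (1 / 10) ^ d) (ENNReal.ofReal 36 ^ d)
      (fun (w : Fin d → ℤ × ℤ) (y : Fin d → ℝ) => ∏ i, unitState (w i) (y i)) := by
  induction d with
  -- Here the space is a point of mass one and there is a single state, equal to `1`.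
  | zero =>
    have hv : (volume : Measure (Fin 0 → ℝ)) = Measure.dirac (fun a => isEmptyElim a) :=
      Measure.volume_pi_eq_dirac
    have hu : ∀ g : ℂ, ∑' _ : Fin 0 → ℤ × ℤ, ‖g‖ₑ ^ 2 = ‖g‖ₑ ^ 2 := fun g => by
      rw [tsum_fintype]
      simp
    refine ⟨fun i => ?_, fun f _ => ?_, fun f _ => ?_⟩
    · simp only [Finset.univ_eq_empty, Finset.prod_empty]
      exact memLp_const 1
    · simp [hv]
    · simp [hv]
  | succ d ih =>
    have h := (hasFrameBounds_unitState.prod ih (ENNReal.pow_ne_top ENNReal.ofReal_ne_top)).comp_equiv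
      (MeasurableEquiv.piFinSuccAbove (fun _ => ℝ) 0)
      (volume_preserving_piFinSuccAbove (fun _ => ℝ) 0)
      (Fin.consEquiv (fun _ : Fin (d + 1) => ℤ × ℤ)).symm
    rw [← pow_succ', ← pow_succ'] at h
    have he : (fun (w : Fin (d + 1) → ℤ × ℤ) (y : Fin (d + 1) → ℝ) =>
        ∏ i, unitState (w i) (y i)) = fun w y =>
        unitState (w 0) (y 0) * ∏ i : Fin d, unitState (w i.succ) (y i.succ) := by
      funext w y
      exact Fin.prod_univ_succ _
    rw [he]
    exact h

/-- Since `k √(π/k)² = π`, this dilation removes `k` from both the Gaussian and the phase, which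
then factor over the coordinates. -/
lemma gaussianState_smul {d : ℕ} {k : ℝ} (hk : 0 < k) (z : Lattice d) (y : Space d) :
    gaussianState k z (Real.sqrt (Real.pi / k) • y) =
      (((k / Real.pi) ^ ((d : ℝ) / 4) : ℝ) : ℂ) * ∏ i, unitState (z.1 i, z.2 i) (y i) := by
  have hs2 : Real.sqrt (Real.pi / k) ^ 2 = Real.pi / k :=
    Real.sq_sqrt (div_pos Real.pi_pos hk).le
  have hks : k * Real.sqrt (Real.pi / k) ^ 2 = Real.pi := by
    rw [hs2]
    field_simp
  have h1 : -(k / 2) * ‖Real.sqrt (Real.pi / k) • y - latticePoint k z.1‖ ^ 2 =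
      ∑ i, -(Real.pi / 2) * (y i - z.1 i) ^ 2 := by
    rw [EuclideanSpace.norm_sq_eq, Finset.mul_sum]
    refine Finset.sum_congr rfl fun i _ => ?_
    simp only [latticePoint, PiLp.sub_apply, PiLp.smul_apply, smul_eq_mul, Real.norm_eq_abs, sq_abs]
    linear_combination (-(1 / 2) * (y i - z.1 i) ^ 2) * hks
  have h2 : k * inner ℝ (Real.sqrt (Real.pi / k) • y - latticePoint k z.1) (latticePoint k z.2) =
      ∑ i, Real.pi * (y i - z.1 i) * z.2 i := by
    rw [PiLp.inner_apply, Finset.mul_sum]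
    refine Finset.sum_congr rfl fun i _ => ?_
    simp only [latticePoint, PiLp.sub_apply, PiLp.smul_apply, smul_eq_mul, RCLike.inner_apply,
      conj_trivial]
    linear_combination ((y i - z.1 i) * z.2 i) * hks
  unfold gaussianState unitState
  rw [h1, h2, Real.exp_sum, Complex.ofReal_sum, Finset.mul_sum, Complex.exp_sum,
    Complex.ofReal_mul, Complex.ofReal_prod, Finset.prod_mul_distrib, mul_assoc]

lemma hasFrameBounds_gaussianState {d : ℕ} {k : ℝ} (hk : 0 < k) :
    HasFrameBounds (volume : Measure (Space d)) (ENNReal.ofReal (1 / 10) ^ d)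
      (ENNReal.ofReal 36 ^ d) (gaussianState k) := by
  have h := (hasFrameBounds_prod_unitState d).comp_equiv (MeasurableEquiv.toLp 2 (Fin d → ℝ)).symm
    (EuclideanSpace.volume_preserving_symm_measurableEquiv_toLp (Fin d))
    (Equiv.arrowProdEquivProdArrow (Fin d) (fun _ => ℤ) (fun _ => ℤ)).symm
  have hpos : 0 < k / Real.pi := div_pos hk Real.pi_pos
  refine h.comp_smul (s := Real.sqrt (Real.pi / k)) (Real.sqrt_pos.2 (div_pos Real.pi_pos hk))
    (c := (((k / Real.pi) ^ ((d : ℝ) / 4) : ℝ) : ℂ)) ?_ fun z y => ?_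
  · rw [Complex.norm_real, Real.norm_of_nonneg (by positivity), finrank_euclideanSpace_fin,
      ← Real.rpow_natCast, ← Real.rpow_mul hpos.le, Real.sqrt_eq_rpow, ← Real.rpow_natCast,
      ← Real.rpow_mul (div_pos Real.pi_pos hk).le, ← inv_div k, Real.inv_rpow hpos.le,
      ← div_eq_mul_inv]
    rw [div_eq_one_iff_eq (by positivity)]
    congr 1
    push_cast
    ring
  · rw [gaussianState_smul hk]
    rfl

lemma enorm_sq_eq_lintegral {X : Type*} [MeasurableSpace X] {μ : Measure X} (u : Lp ℂ 2 μ) :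
    ‖u‖ₑ ^ 2 = ∫⁻ x, ‖u x‖ₑ ^ 2 ∂μ := by
  rw [Lp.enorm_def, eLpNorm_eq_lintegral_rpow_enorm_toReal (by norm_num) (by norm_num),
    ← ENNReal.rpow_natCast, ← ENNReal.rpow_mul]
  simp

lemma isFrame_gaborState {d : ℕ} {k : ℝ} (hk : 0 < k) :
    IsFrame ((1 / 10) ^ d) (36 ^ d) (gaborState (d := d) hk) := by
  have hb := hasFrameBounds_gaussianState (d := d) hk
  have hinner : ∀ (z : Lattice d) (u : L2 d), (inner ℂ (gaborState hk z) u : ℂ) =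
      ∫ x, u x * (starRingEnd ℂ) (gaussianState k z x) := by
    intro z u
    rw [L2.inner_def]
    refine integral_congr_ae ?_
    filter_upwards [(memLp_gaussianState hk z).coeFn_toLp] with x hx
    rw [gaborState, hx]
    rfl
  have hsq : ∀ u : L2 d, ∑' z, ‖(inner ℂ (gaborState hk z) u : ℂ)‖ₑ ^ 2 =
      ∑' z, ENNReal.ofReal (‖(inner ℂ (gaborState hk z) u : ℂ)‖ ^ 2) := by
    intro u
    refine tsum_congr fun z => ?_
    rw [ENNReal.ofReal_pow (norm_nonneg _), ofReal_norm]
  have hn : ∀ u : L2 d, ‖u‖ₑ ^ 2 = ENNReal.ofReal (‖u‖ ^ 2) := by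
    intro u
    rw [ENNReal.ofReal_pow (norm_nonneg _), ofReal_norm]
  have hlo : ∀ u : L2 d, ENNReal.ofReal ((1 / 10) ^ d * ‖u‖ ^ 2) ≤
      ∑' z, ENNReal.ofReal (‖(inner ℂ (gaborState hk z) u : ℂ)‖ ^ 2) := by
    intro u
    rw [ENNReal.ofReal_mul (by positivity), ENNReal.ofReal_pow (by norm_num), ← hn,
      enorm_sq_eq_lintegral, ← hsq]
    simp only [hinner]
    exact hb.lower u (Lp.memLp u)
  have hup : ∀ u : L2 d, ∑' z, ENNReal.ofReal (‖(inner ℂ (gaborState hk z) u : ℂ)‖ ^ 2) ≤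
      ENNReal.ofReal (36 ^ d * ‖u‖ ^ 2) := by
    intro u
    rw [ENNReal.ofReal_mul (by positivity), ENNReal.ofReal_pow (by norm_num), ← hn,
      enorm_sq_eq_lintegral, ← hsq]
    simp only [hinner]
    exact hb.upper u (Lp.memLp u)
  have hsum : ∀ u : L2 d, Summable fun z => ‖(inner ℂ (gaborState hk z) u : ℂ)‖ ^ 2 := by
    intro u
    have := ENNReal.summable_toReal ((hup u).trans_lt ENNReal.ofReal_lt_top).ne
    refine this.congr fun z => ENNReal.toReal_ofReal (sq_nonneg _)
  refine ⟨by positivity, hsum, fun u => ?_, fun u => ?_⟩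
  · have := hlo u
    rw [← ENNReal.ofReal_tsum_of_nonneg (fun _ => sq_nonneg _) (hsum u)] at this
    exact (ENNReal.ofReal_le_ofReal_iff (tsum_nonneg fun _ => sq_nonneg _)).1 this
  · have := hup u
    rw [← ENNReal.ofReal_tsum_of_nonneg (fun _ => sq_nonneg _) (hsum u)] at this
    exact (ENNReal.ofReal_le_ofReal_iff (by positivity)).1 this

end GaussianFrame

/-! ### Gaussians as Schwartz functions -/

section SchwartzGaussian

variable {E : Type*} [NormedAddCommGroup E] [InnerProductSpace ℝ E]

/-- `(1 + t)^N ≤ N! exp(1 + t)`, and `1 + t - t²/2 ≤ 3/2`. -/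
lemma one_add_pow_mul_exp_le (N : ℕ) {t : ℝ} (ht : 0 ≤ t) :
    (1 + t) ^ N * Real.exp (-(1 / 2) * t ^ 2) ≤ N.factorial * Real.exp (3 / 2) := by
  have h1 := Real.pow_div_factorial_le_exp (1 + t) (by linarith) N
  rw [div_le_iff₀ (by positivity)] at h1
  calc (1 + t) ^ N * Real.exp (-(1 / 2) * t ^ 2)
      ≤ Real.exp (1 + t) * N.factorial * Real.exp (-(1 / 2) * t ^ 2) := by gcongr
    _ = N.factorial * Real.exp (1 + t + -(1 / 2) * t ^ 2) := by
      rw [Real.exp_add (1 + t)]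
      ring
    _ ≤ N.factorial * Real.exp (3 / 2) := by
      gcongr
      nlinarith [sq_nonneg (t - 1)]

variable (E) in
/-- The Gaussian `exp(-‖x‖²/2)` as a real valued Schwartz function. -/
def realGaussian : 𝓢(E, ℝ) where
  toFun x := Real.exp (-(1 / 2) * ‖x‖ ^ 2)
  smooth' := (contDiff_const.mul (contDiff_norm_sq ℝ)).exp
  decay' k n := by
    obtain ⟨l, C, hC, hbound⟩ :=
      (Function.hasTemperateGrowth_norm_sq E).norm_iteratedFDeriv_le_uniform n
    refine ⟨n.factorial * (C + 1) ^ n * ((k + l * n).factorial * Real.exp (3 / 2)), fun x => ?_⟩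
    have hcomp : (fun x : E => Real.exp (-(1 / 2) * ‖x‖ ^ 2)) =
        (fun t : ℝ => Real.exp (-(1 / 2) * t)) ∘ fun x : E => ‖x‖ ^ 2 := rfl
    have h1 : ∀ i ≤ n, ‖iteratedFDeriv ℝ i (fun t : ℝ => Real.exp (-(1 / 2) * t)) (‖x‖ ^ 2)‖ ≤
        Real.exp (-(1 / 2) * ‖x‖ ^ 2) := by
      intro i _
      rw [norm_iteratedFDeriv_eq_norm_iteratedDeriv, iteratedDeriv_exp_const_mul, norm_mul,
        Real.norm_of_nonneg (Real.exp_pos _).le, norm_pow]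
      refine mul_le_of_le_one_left (Real.exp_pos _).le (pow_le_one₀ (norm_nonneg _) ?_)
      norm_num
    have h2 : ∀ i, 1 ≤ i → i ≤ n → ‖iteratedFDeriv ℝ i (fun x : E => ‖x‖ ^ 2) x‖ ≤
        ((C + 1) * (1 + ‖x‖) ^ l) ^ i := by
      intro i hi hin
      refine (hbound i hin x).trans ?_
      have h3 : 1 ≤ (C + 1) * (1 + ‖x‖) ^ l :=
        one_le_mul_of_one_le_of_one_le (by linarith) (one_le_pow₀ (by simp))
      refine le_trans ?_ (le_self_pow₀ h3 (by omega))
      gcongr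
      linarith
    -- Faà di Bruno bound for `exp(-t/2)` composed with `‖x‖²`: derivatives of the outer function
    -- are bounded by its value, those of the inner one grow polynomially.
    have h4 := norm_iteratedFDeriv_comp_le (n := n) (N := (⊤ : ℕ∞))
      (g := fun t : ℝ => Real.exp (-(1 / 2) * t)) (f := fun x : E => ‖x‖ ^ 2)
      (by fun_prop) (contDiff_norm_sq ℝ) (mod_cast le_top) x h1 h2
    rw [hcomp]
    calc ‖x‖ ^ k * _ ≤ (1 + ‖x‖) ^ k * (n.factorial * Real.exp (-(1 / 2) * ‖x‖ ^ 2) *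
          ((C + 1) * (1 + ‖x‖) ^ l) ^ n) := by
          gcongr
          linarith
      _ = n.factorial * (C + 1) ^ n *
          ((1 + ‖x‖) ^ (k + l * n) * Real.exp (-(1 / 2) * ‖x‖ ^ 2)) := by
          rw [mul_pow, ← pow_mul, pow_add]
          ring
      _ ≤ _ := by
          gcongr ?_ * ?_
          exact one_add_pow_mul_exp_le _ (norm_nonneg x)

variable (E) in
/-- The Gaussian `exp(-‖x‖²/2)` as a complex valued Schwartz function. -/
def complexGaussian : 𝓢(E, ℂ) := (realGaussian E).postcompCLM Complex.ofRealCLM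

lemma complexGaussian_apply (x : E) :
    complexGaussian E x = ((Real.exp (-(1 / 2) * ‖x‖ ^ 2) : ℝ) : ℂ) := rfl

lemma hasTemperateGrowth_cexp_ofReal_mul_I :
    Function.HasTemperateGrowth fun t : ℝ => Complex.exp (Complex.I * (t : ℂ)) := by
  refine ⟨(contDiff_const.mul Complex.ofRealCLM.contDiff).cexp, fun n => ⟨0, 1, fun t => ?_⟩⟩
  have h : ∀ n : ℕ, iteratedDeriv n (fun t : ℝ => Complex.exp (Complex.I * (t : ℂ))) =
      fun t : ℝ => Complex.I ^ n * Complex.exp (Complex.I * (t : ℂ)) := by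
    intro n
    induction n with
    | zero => simp
    | succ n ih =>
      rw [iteratedDeriv_succ, ih]
      funext t
      have h1 : HasDerivAt (fun t : ℝ => Complex.I * (t : ℂ)) (Complex.I * 1) t :=
        (Complex.ofRealCLM.hasDerivAt).const_mul _
      rw [((h1.cexp).const_mul _).deriv]
      ring
  rw [norm_iteratedFDeriv_eq_norm_iteratedDeriv, h, norm_mul, norm_pow, Complex.norm_I, one_pow,
    mul_comm Complex.I, Complex.norm_exp_ofReal_mul_I]
  simp

/-- The function `x ↦ f (s (x - a))` for a Schwartz function `f` and `s > 0`. -/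
def affinePullback {s : ℝ} (hs : 0 < s) (a : E) (f : 𝓢(E, ℂ)) : 𝓢(E, ℂ) :=
  (SchwartzMap.compCLMOfContinuousLinearEquiv ℂ
    (ContinuousLinearEquiv.smulLeft (R₁ := ℝ) (Units.mk0 s hs.ne')) f).compSubConstCLM ℂ a

lemma affinePullback_apply {s : ℝ} (hs : 0 < s) (a : E) (f : 𝓢(E, ℂ)) (x : E) :
    affinePullback hs a f x = f (s • (x - a)) := rfl

lemma lineDerivOp_affinePullback {s : ℝ} (hs : 0 < s) (a : E) (f : 𝓢(E, ℂ)) (v : E) :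
    ∂_{v} (affinePullback hs a f) = (s : ℂ) • affinePullback hs a (∂_{v} f) := by
  have h1 : ∀ g : 𝓢(E, ℂ), ∂_{v} (g.compSubConstCLM ℂ a) = (∂_{v} g).compSubConstCLM ℂ a := by
    intro g
    ext x
    rw [SchwartzMap.compSubConstCLM_apply, SchwartzMap.lineDerivOp_apply_eq_fderiv,
      SchwartzMap.lineDerivOp_apply_eq_fderiv]
    have : (⇑(g.compSubConstCLM ℂ a) : E → ℂ) = fun x => g (x - a) := rfl
    rw [this, fderiv_comp_sub]
  have h2 : (ContinuousLinearEquiv.smulLeft (R₁ := ℝ) (Units.mk0 s hs.ne') : E ≃L[ℝ] E) v =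
      s • v := rfl
  unfold affinePullback
  rw [h1, SchwartzMap.lineDerivOp_compCLMOfContinuousLinearEquiv, h2,
    LineDeriv.lineDerivOp_left_smul]
  ext x
  rfl

end SchwartzGaussian

/-! ### Derivatives of Schwartz functions and of Gaussian states -/

section Derivatives

variable {d : ℕ}

/-- The partial derivative `∂^a` of a Schwartz function. -/
def schwartzDeriv (a : Fin d → ℕ) (φ : 𝓢(Space d, ℂ)) : 𝓢(Space d, ℂ) :=
  (List.finRange d).foldr
    (fun i S => (fun R : 𝓢(Space d, ℂ) => ∂_{EuclideanSpace.single i (1 : ℝ)} R)^[a i] S) φ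

lemma isDistribDeriv_toLp (a : Fin d → ℕ) (φ : 𝓢(Space d, ℂ)) :
    IsDistribDeriv a (φ.toLp 2 volume) ((schwartzDeriv a φ).toLp 2 volume) := by
  unfold IsDistribDeriv distribDeriv schwartzDeriv
  rw [Lp.toTemperedDistribution_toLp_eq, Lp.toTemperedDistribution_toLp_eq]
  induction List.finRange d with
  | nil => rfl
  | cons i l ih =>
    rw [List.foldr_cons, List.foldr_cons, ih]
    generalize List.foldr _ φ l = ψ
    induction a i with
    | zero => rfl
    | succ n ihn =>
      rw [Function.iterate_succ_apply', Function.iterate_succ_apply', ihn,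
        TemperedDistribution.lineDerivOp_toTemperedDistributionCLM_eq]

/-- Each derivative costs one factor `s`. With `s = √k` the total is `k^{[a]/2}`, which the weight
`k^{-2[a]}` of the squared norm absorbs. -/
lemma schwartzDeriv_smul_affinePullback {s : ℝ} (hs : 0 < s) (x₀ : Space d) (c : ℂ) (a : Fin d → ℕ)
    (φ : 𝓢(Space d, ℂ)) : schwartzDeriv a (c • affinePullback hs x₀ φ) =
      (c * (s : ℂ) ^ ∑ i, a i) • affinePullback hs x₀ (schwartzDeriv a φ) := by
  have hiter : ∀ (v : Space d) (n : ℕ) (b : ℂ) (ψ : 𝓢(Space d, ℂ)),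
      (fun R : 𝓢(Space d, ℂ) => ∂_{v} R)^[n] (b • affinePullback hs x₀ ψ) =
        (b * (s : ℂ) ^ n) • affinePullback hs x₀ ((fun R : 𝓢(Space d, ℂ) => ∂_{v} R)^[n] ψ) := by
    intro v n b ψ
    induction n with
    | zero => simp
    | succ n ih =>
      rw [Function.iterate_succ_apply', Function.iterate_succ_apply', ih,
        LineDeriv.lineDerivOp_smul, lineDerivOp_affinePullback, smul_smul]
      congr 1
      ring
  have hsum : ∑ i, a i = ((List.finRange d).map a).sum := by
    rw [← List.sum_ofFn, List.ofFn_eq_map]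
  unfold schwartzDeriv
  rw [hsum]
  induction List.finRange d with
  | nil => simp
  | cons i l ih =>
    rw [List.foldr_cons, List.foldr_cons, ih, hiter, List.map_cons, List.sum_cons]
    congr 1
    ring

/-- The modulated states `n ≠ 0` are included because they occur in `Π_D u`; only membership in the
Schwartz space matters for them. -/
lemma gaussianState_eq_schwartz {k : ℝ} (hk : 0 < k) (z : Lattice d) :
    ∃ φ : 𝓢(Space d, ℂ), (φ : Space d → ℂ) = gaussianState k z := by
  have hchar : Function.HasTemperateGrowth fun x : Space d => Complex.exp (Complex.I *
      ((k * inner ℝ (x - latticePoint k z.1) (latticePoint k z.2) : ℝ) : ℂ)) := by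
    refine hasTemperateGrowth_cexp_ofReal_mul_I.comp
      (f := fun x : Space d => k * inner ℝ (x - latticePoint k z.1) (latticePoint k z.2)) ?_
    have h1 : Function.HasTemperateGrowth fun x : Space d => x - latticePoint k z.1 := by fun_prop
    exact (Function.HasTemperateGrowth.const k).mul
      ((Function.hasTemperateGrowth_inner_left (latticePoint k z.2)).comp h1)
  refine ⟨(((k / Real.pi) ^ ((d : ℝ) / 4) : ℝ) : ℂ) •
    SchwartzMap.smulLeftCLM (𝕜 := ℂ) ℂ (fun x : Space d => Complex.exp (Complex.I *
      ((k * inner ℝ (x - latticePoint k z.1) (latticePoint k z.2) : ℝ) : ℂ)))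
    (affinePullback (Real.sqrt_pos.2 hk) (latticePoint k z.1) (complexGaussian (Space d))), ?_⟩
  funext x
  rw [smul_apply, SchwartzMap.smulLeftCLM_apply_apply hchar, affinePullback_apply,
    complexGaussian_apply, norm_smul, mul_pow, Real.norm_eq_abs, sq_abs, Real.sq_sqrt hk.le,
    gaussianState, smul_eq_mul, smul_eq_mul, Complex.ofReal_mul (_ ^ _)]
  rw [show -(1 / 2) * (k * ‖x - latticePoint k z.1‖ ^ 2) =
    -(k / 2) * ‖x - latticePoint k z.1‖ ^ 2 by ring]
  ring

lemma gaussianState_eq_affinePullback {k : ℝ} (hk : 0 < k) (m : Fin d → ℤ) :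
    gaussianState k (m, 0) = ⇑((((k / Real.pi) ^ ((d : ℝ) / 4) : ℝ) : ℂ) •
      affinePullback (Real.sqrt_pos.2 hk) (latticePoint k m) (complexGaussian (Space d))) := by
  have h0 : latticePoint k (0 : Fin d → ℤ) = 0 := by
    ext i
    simp [latticePoint]
  funext x
  rw [smul_apply, affinePullback_apply, complexGaussian_apply, norm_smul, mul_pow,
    Real.norm_eq_abs, sq_abs, Real.sq_sqrt hk.le, gaussianState, smul_eq_mul, Complex.ofReal_mul,
    h0, inner_zero_right]
  rw [show -(1 / 2) * (k * ‖x - latticePoint k m‖ ^ 2) =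
    -(k / 2) * ‖x - latticePoint k m‖ ^ 2 by ring]
  simp

end Derivatives

/-! ### Upper and lower bounds for the weighted Sobolev norms -/

section WeightedNorms

variable {d : ℕ}

lemma eLpNorm_two_sq {X : Type*} [MeasurableSpace X] (μ : Measure X) (f : X → ℂ) :
    eLpNorm f 2 μ ^ 2 = ∫⁻ x, ‖f x‖ₑ ^ 2 ∂μ := by
  rw [eLpNorm_eq_lintegral_rpow_enorm_toReal (by norm_num) (by norm_num),
    ← ENNReal.rpow_natCast, ← ENNReal.rpow_mul]
  simp

lemma eLpNorm_one_add_norm_pow_mul_lt_top (q : ℕ) (ψ : 𝓢(Space d, ℂ)) :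
    eLpNorm (fun x => (((1 + ‖x‖) ^ q : ℝ) : ℂ) * ψ x) 2 volume < ∞ := by
  -- The weight `1 + ‖x‖` is not smooth at the origin; it is dominated by `2 (1 + ‖x‖²)`, which is.
  have hg : Function.HasTemperateGrowth fun x : Space d => (1 + ‖x‖ ^ 2) ^ q :=
    ((Function.HasTemperateGrowth.const 1).add (Function.hasTemperateGrowth_norm_sq _)).pow q
  have hlt := (SchwartzMap.smulLeftCLM (𝕜 := ℝ) ℂ (fun x : Space d => (1 + ‖x‖ ^ 2) ^ q)
    ψ).eLpNorm_lt_top 2 volume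
  refine lt_of_le_of_lt (eLpNorm_le_mul_eLpNorm_of_ae_le_mul (c := 2 ^ q)
    (Filter.Eventually.of_forall fun x => ?_) 2) (ENNReal.mul_lt_top ENNReal.ofReal_lt_top hlt)
  rw [SchwartzMap.smulLeftCLM_apply_apply hg, norm_mul, norm_smul, Complex.norm_real,
    Real.norm_of_nonneg (by positivity), Real.norm_of_nonneg (by positivity), ← mul_assoc,
    ← mul_pow]
  gcongr
  nlinarith [sq_nonneg (‖x‖ - 1), sq_nonneg ‖x‖]

lemma weightedNorm_toLp_le (q : ℕ) (a : Fin d → ℕ) (φ : 𝓢(Space d, ℂ)) :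
    weightedNorm q a (φ.toLp 2 volume) ≤
      eLpNorm (fun x => ((‖x‖ ^ q : ℝ) : ℂ) * schwartzDeriv a φ x) 2 volume := by
  refine (iInf₂_le _ (isDistribDeriv_toLp a φ)).trans (le_of_eq (eLpNorm_congr_ae ?_))
  filter_upwards [(schwartzDeriv a φ).coeFn_toLp 2 volume] with x hx
  rw [hx]

lemma hatNormSq_toLp_lt_top (p : ℕ) (k : ℝ) (φ : 𝓢(Space d, ℂ)) :
    hatNormSq p k (φ.toLp 2 volume) < ∞ := by
  refine ENNReal.sum_lt_top.2 fun a _ => ENNReal.sum_lt_top.2 fun q _ =>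
    ENNReal.mul_lt_top ENNReal.ofReal_lt_top (ENNReal.pow_lt_top ?_)
  refine (weightedNorm_toLp_le q a φ).trans_lt (lt_of_le_of_lt (eLpNorm_mono fun x => ?_)
    (eLpNorm_one_add_norm_pow_mul_lt_top q (schwartzDeriv a φ)))
  rw [norm_mul, norm_mul, Complex.norm_real, Complex.norm_real,
    Real.norm_of_nonneg (by positivity), Real.norm_of_nonneg (by positivity)]
  gcongr
  linarith

lemma toLp_mem_hatSobolev (p : ℕ) (k : ℝ) (φ : 𝓢(Space d, ℂ)) :
    φ.toLp 2 volume ∈ HatSobolev d p k := by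
  refine ⟨fun _ => φ, ?_⟩
  have h0 : ∀ (q : ℕ) (a : Fin d → ℕ), weightedNorm q a (0 : L2 d) = 0 := by
    intro q a
    -- Writing zero as a zero multiple lets the scaling formula give `∂^a 0 = 0`.
    have h1 : (0 : 𝓢(Space d, ℂ)) =
        (0 : ℂ) • affinePullback one_pos 0 (0 : 𝓢(Space d, ℂ)) := by simp
    have h2 : schwartzDeriv a (0 : 𝓢(Space d, ℂ)) = 0 := by
      rw [h1, schwartzDeriv_smul_affinePullback]
      simp
    have h3 : (0 : 𝓢(Space d, ℂ)).toLp 2 (volume : Measure (Space d)) = 0 :=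
      map_zero (SchwartzMap.toLpCLM ℂ ℂ 2 (volume : Measure (Space d)))
    have h4 := weightedNorm_toLp_le q a (0 : 𝓢(Space d, ℂ))
    rw [h2, h3] at h4
    refine le_antisymm (h4.trans (le_of_eq ?_)) zero_le
    simp
  simp [hatNormSq, h0]

lemma distribDeriv_zero (T : 𝓢'(Space d, ℂ)) : distribDeriv 0 T = T := by
  unfold distribDeriv
  induction List.finRange d with
  | nil => rfl
  | cons i l ih =>
    rw [List.foldr_cons, ih]
    rfl

/-- L² embeds injectively in the tempered distributions, so `w` is the only candidate in the infimum
defining `weightedNorm`. -/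
lemma eLpNorm_le_weightedNorm_zero (q : ℕ) (w : L2 d) :
    eLpNorm (fun x => ((‖x‖ ^ q : ℝ) : ℂ) * w x) 2 volume ≤ weightedNorm q 0 w := by
  refine le_iInf₂ fun v hv => ?_
  unfold IsDistribDeriv at hv
  rw [distribDeriv_zero] at hv
  have hinj := LinearMap.ker_eq_bot.1 (Lp.ker_toTemperedDistributionCLM_eq_bot (F := ℂ)
    (μ := (volume : Measure (Space d))) (p := 2))
  rw [hinj hv]

lemma weightedNorm_zero_sq_le_hatNormSq (p : ℕ) (k : ℝ) (w : L2 d) :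
    weightedNorm p 0 w ^ 2 ≤ hatNormSq p k w := by
  have h0 : (0 : Fin d → ℕ) ∈ multiIndices d p := by simp [multiIndices]
  refine le_trans ?_ (Finset.single_le_sum (f := fun a : Fin d → ℕ =>
    ∑ q ∈ Finset.range (p - ∑ i, a i + 1),
      ENNReal.ofReal ((k ^ (2 * ∑ i, a i))⁻¹) * weightedNorm q a w ^ 2) (fun _ _ => zero_le) h0)
  refine le_trans ?_ (Finset.single_le_sum (f := fun q : ℕ =>
      ENNReal.ofReal ((k ^ (2 * ∑ i, (0 : Fin d → ℕ) i))⁻¹) * weightedNorm q 0 w ^ 2)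
      (fun _ _ => zero_le) (Finset.mem_range.2 (show p < _ by simp)))
  simp

/-- The single term `a = 0`, `q = p` suffices, with weight at least `R^p` on `‖x‖ ≥ R`. Finiteness
is needed since `toReal` sends `∞` to `0`. -/
lemma le_hatNorm {p : ℕ} {k : ℝ} {w : L2 d} (hfin : hatNormSq p k w < ∞) {R t : ℝ} (hR : 0 ≤ R)
    (ht : 0 ≤ t)
    (h : ENNReal.ofReal t ≤ eLpNorm w 2 (volume.restrict {x : Space d | R ≤ ‖x‖})) :
    R ^ p * t ≤ hatNorm p k w := by
  have hS : MeasurableSet {x : Space d | R ≤ ‖x‖} := measurableSet_le measurable_const measurable_norm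
  have h1 : ENNReal.ofReal (R ^ p * t) ≤ weightedNorm p 0 w := by
    refine le_trans ?_ (eLpNorm_le_weightedNorm_zero p w)
    refine le_trans ?_ (eLpNorm_mono_measure _
      (Measure.restrict_le_self (s := {x : Space d | R ≤ ‖x‖})))
    rw [ENNReal.ofReal_mul (by positivity)]
    calc ENNReal.ofReal (R ^ p) * ENNReal.ofReal t
        ≤ ENNReal.ofReal (R ^ p) * eLpNorm w 2 (volume.restrict {x : Space d | R ≤ ‖x‖}) := by
          gcongr
      _ = eLpNorm (((R ^ p : ℝ) : ℂ) • (w : Space d → ℂ)) 2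
            (volume.restrict {x : Space d | R ≤ ‖x‖}) := by
          rw [eLpNorm_const_smul]
          congr 1
          rw [← ofReal_norm, Complex.norm_real, Real.norm_of_nonneg (by positivity)]
      _ ≤ _ := by
          refine eLpNorm_mono_ae ?_
          filter_upwards [ae_restrict_mem hS] with x hx
          rw [Pi.smul_apply, smul_eq_mul, norm_mul, norm_mul, Complex.norm_real, Complex.norm_real,
            Real.norm_of_nonneg (by positivity), Real.norm_of_nonneg (by positivity)]
          have : R ≤ ‖x‖ := hx
          gcongr
  have h2 : ENNReal.ofReal ((R ^ p * t) ^ 2) ≤ hatNormSq p k w := by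
    rw [ENNReal.ofReal_pow (by positivity)]
    exact (pow_le_pow_left₀ zero_le h1 2).trans (weightedNorm_zero_sq_le_hatNormSq p k w)
  refine Real.le_sqrt_of_sq_le ?_
  have h3 := ENNReal.toReal_mono hfin.ne h2
  rwa [ENNReal.toReal_ofReal (sq_nonneg _)] at h3

lemma sq_rpow_div_four {x : ℝ} (hx : 0 ≤ x) (d : ℕ) :
    (x ^ ((d : ℝ) / 4)) ^ 2 = Real.sqrt x ^ d := by
  rw [Real.sqrt_eq_rpow, ← Real.rpow_natCast, ← Real.rpow_mul hx, ← Real.rpow_natCast,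
    ← Real.rpow_mul hx]
  congr 1
  push_cast
  ring

lemma gaussian_mass_le_one {k : ℝ} (hk : 0 < k) (d : ℕ) :
    (Real.sqrt k)⁻¹ ^ d * ((k / Real.pi) ^ ((d : ℝ) / 4)) ^ 2 ≤ 1 := by
  rw [sq_rpow_div_four (div_pos hk Real.pi_pos).le, ← mul_pow, Real.sqrt_div hk.le,
    ← mul_div_assoc, inv_mul_cancel₀ (Real.sqrt_pos.2 hk).ne']
  refine pow_le_one₀ (by positivity) ?_
  rw [div_le_one (Real.sqrt_pos.2 Real.pi_pos)]
  exact Real.one_le_sqrt.2 (by linarith [Real.pi_gt_three])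

/-- Substitute `x = y/√k + x₀`. Then `‖x‖ ≤ X (1 + ‖y‖)`, the Jacobian compensates the
normalization, and the derivatives contribute `k^{[a]} ≤ k^{2[a]}`. What remains depends only on
`G`. -/
lemma weighted_term_le {P q : ℕ} (hq : q ≤ P) (a : Fin d → ℕ) {k X : ℝ} (hk : 1 ≤ k) (hX : 1 ≤ X)
    {x₀ : Space d} (hx₀ : ‖x₀‖ ≤ X) (G : 𝓢(Space d, ℂ)) :
    ENNReal.ofReal ((k ^ (2 * ∑ i, a i))⁻¹) *
      weightedNorm q a (((((k / Real.pi) ^ ((d : ℝ) / 4) : ℝ) : ℂ) •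
        affinePullback (Real.sqrt_pos.2 (zero_lt_one.trans_le hk)) x₀ G).toLp 2 volume) ^ 2 ≤
      ENNReal.ofReal (X ^ (2 * P)) *
        eLpNorm (fun y => (((1 + ‖y‖) ^ q : ℝ) : ℂ) * schwartzDeriv a G y) 2 volume ^ 2 := by
  have hk0 : 0 < k := zero_lt_one.trans_le hk
  set s : ℝ := Real.sqrt k with hs
  have hs0 : 0 < s := Real.sqrt_pos.2 hk0
  have hs1 : 1 ≤ s := Real.one_le_sqrt.2 hk
  set c : ℝ := (k / Real.pi) ^ ((d : ℝ) / 4) with hc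
  have hc0 : 0 ≤ c := by positivity
  set α := ∑ i, a i with hα
  have hpt : ∀ y : Space d, ‖(((‖s⁻¹ • y + x₀‖ ^ q : ℝ) : ℂ) *
      ((((c : ℂ) * (s : ℂ) ^ α) • affinePullback hs0 x₀ (schwartzDeriv a G)) (s⁻¹ • y + x₀)))‖ₑ ^ 2 ≤
      ENNReal.ofReal ((X ^ q * c * s ^ α) ^ 2) *
        ‖(((1 + ‖y‖) ^ q : ℝ) : ℂ) * schwartzDeriv a G y‖ₑ ^ 2 := by
    intro y
    rw [← ofReal_norm, ← ofReal_norm, ← ENNReal.ofReal_pow (norm_nonneg _),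
      ← ENNReal.ofReal_pow (norm_nonneg _), ← ENNReal.ofReal_mul (sq_nonneg _), ← mul_pow]
    refine ENNReal.ofReal_le_ofReal (pow_le_pow_left₀ (norm_nonneg _) ?_ 2)
    rw [smul_apply, affinePullback_apply, add_sub_cancel_right, smul_inv_smul₀ hs0.ne',
      smul_eq_mul, norm_mul, norm_mul, norm_mul, norm_mul, norm_pow, Complex.norm_real,
      Complex.norm_real, Complex.norm_real, Complex.norm_real, Real.norm_of_nonneg hc0,
      Real.norm_of_nonneg hs0.le, Real.norm_of_nonneg (by positivity),
      Real.norm_of_nonneg (by positivity)]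
    have h1 : ‖s⁻¹ • y + x₀‖ ≤ X * (1 + ‖y‖) := by
      calc ‖s⁻¹ • y + x₀‖ ≤ ‖s⁻¹ • y‖ + ‖x₀‖ := norm_add_le _ _
        _ ≤ 1 * ‖y‖ + X := by
          rw [norm_smul, Real.norm_of_nonneg (by positivity)]
          gcongr
          exact inv_le_one_of_one_le₀ hs1
        _ ≤ X * (1 + ‖y‖) := by nlinarith [norm_nonneg y]
    have h2 : ‖s⁻¹ • y + x₀‖ ^ q ≤ X ^ q * (1 + ‖y‖) ^ q := by
      rw [← mul_pow]
      exact pow_le_pow_left₀ (norm_nonneg _) h1 q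
    calc ‖s⁻¹ • y + x₀‖ ^ q * (c * s ^ α * ‖schwartzDeriv a G y‖)
        ≤ (X ^ q * (1 + ‖y‖) ^ q) * (c * s ^ α * ‖schwartzDeriv a G y‖) := by gcongr
      _ = _ := by ring
  have hreal : (k ^ (2 * α))⁻¹ * (s⁻¹ ^ d * (X ^ q * c * s ^ α) ^ 2) ≤ X ^ (2 * P) := by
    have h1 : s⁻¹ ^ d * c ^ 2 ≤ 1 := gaussian_mass_le_one hk0 d
    have h2 : (s ^ α) ^ 2 = k ^ α := by
      rw [← pow_mul, mul_comm, pow_mul, hs, Real.sq_sqrt hk0.le]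
    have h3 : (k ^ (2 * α))⁻¹ * k ^ α ≤ 1 := by
      rw [inv_mul_le_one₀ (by positivity)]
      exact pow_le_pow_right₀ hk (by omega)
    calc (k ^ (2 * α))⁻¹ * (s⁻¹ ^ d * (X ^ q * c * s ^ α) ^ 2)
        = ((k ^ (2 * α))⁻¹ * k ^ α) * (s⁻¹ ^ d * c ^ 2) * X ^ (2 * q) := by
          rw [← h2]
          ring
      _ ≤ 1 * 1 * X ^ (2 * P) := by
          gcongr
      _ = X ^ (2 * P) := by ring
  calc _ ≤ ENNReal.ofReal ((k ^ (2 * α))⁻¹) * eLpNorm (fun x => ((‖x‖ ^ q : ℝ) : ℂ) *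
          (((c : ℂ) * (s : ℂ) ^ α) • affinePullback hs0 x₀ (schwartzDeriv a G)) x) 2 volume ^ 2 := by
        gcongr
        refine (weightedNorm_toLp_le q a _).trans (le_of_eq ?_)
        rw [schwartzDeriv_smul_affinePullback]
    _ = ENNReal.ofReal ((k ^ (2 * α))⁻¹) * (ENNReal.ofReal (s⁻¹ ^ d) *
          ∫⁻ y : Space d, ‖(((‖s⁻¹ • y + x₀‖ ^ q : ℝ) : ℂ) * ((((c : ℂ) * (s : ℂ) ^ α) •
            affinePullback hs0 x₀ (schwartzDeriv a G)) (s⁻¹ • y + x₀)))‖ₑ ^ 2) := by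
        rw [eLpNorm_two_sq, ← lintegral_add_right_eq_self _ x₀,
          lintegral_eq_mul_lintegral_comp_smul (inv_pos.2 hs0), finrank_euclideanSpace_fin]
    _ ≤ ENNReal.ofReal ((k ^ (2 * α))⁻¹) * (ENNReal.ofReal (s⁻¹ ^ d) *
          (ENNReal.ofReal ((X ^ q * c * s ^ α) ^ 2) *
            eLpNorm (fun y => (((1 + ‖y‖) ^ q : ℝ) : ℂ) * schwartzDeriv a G y) 2 volume ^ 2)) := by
        rw [eLpNorm_two_sq, ← lintegral_const_mul' (ENNReal.ofReal ((X ^ q * c * s ^ α) ^ 2)) _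
          ENNReal.ofReal_ne_top]
        exact mul_le_mul_right (mul_le_mul_right (lintegral_mono hpt) _) _
    _ ≤ _ := by
        rw [← mul_assoc, ← mul_assoc, mul_assoc (ENNReal.ofReal ((k ^ (2 * α))⁻¹)),
          ← ENNReal.ofReal_mul (by positivity), ← ENNReal.ofReal_mul (by positivity)]
        gcongr

lemma gaborState_eq_toLp {k : ℝ} (hk : 0 < k) (z : Lattice d) {φ : 𝓢(Space d, ℂ)}
    (hφ : (φ : Space d → ℂ) = gaussianState k z) : gaborState hk z = φ.toLp 2 volume := by
  refine Lp.ext ?_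
  filter_upwards [(memLp_gaussianState hk z).coeFn_toLp, φ.coeFn_toLp 2 volume] with x h1 h2
  rw [gaborState, h1, h2, hφ]

lemma exists_hatNorm_gaborState_le (d P : ℕ) : ∃ K : ℝ, 0 < K ∧
    ∀ (k : ℝ) (hk : 1 ≤ k) (X : ℝ) (m : Fin d → ℤ), 1 ≤ X → ‖latticePoint k m‖ ≤ X →
      hatNorm P k (gaborState (zero_lt_one.trans_le hk) (m, 0)) ≤ K * X ^ P := by
  set J : ℝ≥0∞ := ∑ a ∈ multiIndices d P, ∑ q ∈ Finset.range (P - ∑ i, a i + 1),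
    eLpNorm (fun y => (((1 + ‖y‖) ^ q : ℝ) : ℂ) *
      schwartzDeriv a (complexGaussian (Space d)) y) 2 volume ^ 2 with hJ
  have hJfin : J < ∞ := ENNReal.sum_lt_top.2 fun a _ => ENNReal.sum_lt_top.2 fun q _ =>
    ENNReal.pow_lt_top (eLpNorm_one_add_norm_pow_mul_lt_top q _)
  refine ⟨Real.sqrt J.toReal + 1, by positivity, fun k hk X m hX hm => ?_⟩
  have hk0 : 0 < k := zero_lt_one.trans_le hk
  have hle : hatNormSq P k (gaborState hk0 (m, 0)) ≤ ENNReal.ofReal (X ^ (2 * P)) * J := by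
    rw [gaborState_eq_toLp hk0 _ (gaussianState_eq_affinePullback hk0 m).symm, hJ, Finset.mul_sum]
    unfold hatNormSq
    refine Finset.sum_le_sum fun a _ => ?_
    rw [Finset.mul_sum (a := ENNReal.ofReal (X ^ (2 * P)))]
    refine Finset.sum_le_sum fun q hq => ?_
    exact weighted_term_le (by have := Finset.mem_range.1 hq; omega) a hk hX hm _
  have h1 := ENNReal.toReal_mono (ENNReal.mul_ne_top ENNReal.ofReal_ne_top hJfin.ne) hle
  rw [ENNReal.toReal_mul, ENNReal.toReal_ofReal (by positivity)] at h1
  unfold hatNorm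
  calc Real.sqrt _ ≤ Real.sqrt (X ^ (2 * P) * J.toReal) := Real.sqrt_le_sqrt h1
    _ = X ^ P * Real.sqrt J.toReal := by
      rw [mul_comm 2 P, pow_mul, Real.sqrt_mul (sq_nonneg _), Real.sqrt_sq (by positivity)]
    _ ≤ (Real.sqrt J.toReal + 1) * X ^ P := by
      have : 0 ≤ X ^ P := by positivity
      nlinarith

end WeightedNorms

/-! ### Localization of the states and of the projection -/

section Localization

variable {d : ℕ}

lemma lintegral_exp_neg_mul_sq_norm_sub {b : ℝ} (hb : 0 < b) (x₀ : Space d) :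
    ∫⁻ x, ENNReal.ofReal (Real.exp (-b * ‖x - x₀‖ ^ 2)) =
      ENNReal.ofReal (Real.sqrt (Real.pi / b) ^ d) := by
  have hI := GaussianFourier.integral_rexp_neg_mul_sq_norm (V := Space d) hb
  have hpos : 0 < (Real.pi / b) ^ ((Module.finrank ℝ (Space d) : ℝ) / 2) :=
    Real.rpow_pos_of_pos (div_pos Real.pi_pos hb) _
  have hint : Integrable fun x : Space d => Real.exp (-b * ‖x‖ ^ 2) := by
    by_contra h
    rw [integral_undef h] at hI
    exact hpos.ne hI
  rw [lintegral_sub_right_eq_self (fun x : Space d => ENNReal.ofReal (Real.exp (-b * ‖x‖ ^ 2))) x₀,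
    ← ofReal_integral_eq_lintegral_ofReal hint
      (Filter.Eventually.of_forall fun _ => (Real.exp_pos _).le), hI, finrank_euclideanSpace_fin,
    Real.sqrt_eq_rpow, ← Real.rpow_natCast, ← Real.rpow_mul (div_pos Real.pi_pos hb).le]
  congr 2
  ring

lemma enorm_gaussianState_sq {k : ℝ} (hk : 0 < k) (z : Lattice d) (x : Space d) :
    ‖gaussianState k z x‖ₑ ^ 2 = ENNReal.ofReal (Real.sqrt (k / Real.pi) ^ d) *
      ENNReal.ofReal (Real.exp (-k * ‖x - latticePoint k z.1‖ ^ 2)) := by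
  rw [← ofReal_norm, ← ENNReal.ofReal_pow (norm_nonneg _), norm_gaussianState hk, mul_pow,
    sq_rpow_div_four (div_pos hk Real.pi_pos).le, ← Real.exp_nat_mul,
    ENNReal.ofReal_mul (by positivity)]
  congr 3
  push_cast
  ring

lemma eLpNorm_gaussianState_sq {k : ℝ} (hk : 0 < k) (z : Lattice d) :
    eLpNorm (gaussianState k z) 2 volume ^ 2 = 1 := by
  rw [eLpNorm_two_sq]
  simp only [enorm_gaussianState_sq hk]
  rw [lintegral_const_mul' _ _ ENNReal.ofReal_ne_top, lintegral_exp_neg_mul_sq_norm_sub hk,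
    ← ENNReal.ofReal_mul (by positivity), ← mul_pow,
    ← Real.sqrt_mul (div_pos hk Real.pi_pos).le, div_mul_div_cancel₀ Real.pi_pos.ne',
    div_self hk.ne']
  simp

/-- Half of the exponent in `exp(-k‖x - x_m‖²)` gives the decay; the other half is integrated over
the whole space and costs `√2^d ≤ 2^d`. -/
lemma eLpNorm_gaussianState_restrict_sq_le {k R : ℝ} (hk : 0 < k) (hR : 0 ≤ R) (z : Lattice d)
    {S : Set (Space d)} (hS : MeasurableSet S) (h : ∀ x ∈ S, R ≤ ‖x - latticePoint k z.1‖) :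
    eLpNorm (gaussianState k z) 2 (volume.restrict S) ^ 2 ≤
      ENNReal.ofReal (2 ^ d * Real.exp (-(k / 2) * R ^ 2)) := by
  rw [eLpNorm_two_sq]
  calc ∫⁻ x in S, ‖gaussianState k z x‖ₑ ^ 2
      ≤ ∫⁻ x in S, ENNReal.ofReal (Real.sqrt (k / Real.pi) ^ d * Real.exp (-(k / 2) * R ^ 2)) *
          ENNReal.ofReal (Real.exp (-(k / 2) * ‖x - latticePoint k z.1‖ ^ 2)) := by
        refine setLIntegral_mono' hS fun x hx => ?_
        rw [enorm_gaussianState_sq hk, ENNReal.ofReal_mul (by positivity), mul_assoc,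
          ← ENNReal.ofReal_mul (Real.exp_pos _).le, ← Real.exp_add]
        gcongr
        have h1 : R ^ 2 ≤ ‖x - latticePoint k z.1‖ ^ 2 := pow_le_pow_left₀ hR (h x hx) 2
        nlinarith
    _ ≤ ∫⁻ x, ENNReal.ofReal (Real.sqrt (k / Real.pi) ^ d * Real.exp (-(k / 2) * R ^ 2)) *
          ENNReal.ofReal (Real.exp (-(k / 2) * ‖x - latticePoint k z.1‖ ^ 2)) :=
        setLIntegral_le_lintegral _ _
    _ ≤ _ := by
        rw [lintegral_const_mul' _ _ ENNReal.ofReal_ne_top,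
          lintegral_exp_neg_mul_sq_norm_sub (half_pos hk), ← ENNReal.ofReal_mul (by positivity)]
        refine ENNReal.ofReal_le_ofReal ?_
        have h1 : Real.sqrt (k / Real.pi) * Real.sqrt (Real.pi / (k / 2)) ≤ 2 := by
          rw [← Real.sqrt_mul (div_pos hk Real.pi_pos).le, div_mul_div_cancel₀ Real.pi_pos.ne',
            div_div_eq_mul_div, mul_div_cancel_left₀ _ hk.ne']
          rw [Real.sqrt_le_left (by norm_num)]
          norm_num
        calc Real.sqrt (k / Real.pi) ^ d * Real.exp (-(k / 2) * R ^ 2) *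
              Real.sqrt (Real.pi / (k / 2)) ^ d
            = (Real.sqrt (k / Real.pi) * Real.sqrt (Real.pi / (k / 2))) ^ d *
              Real.exp (-(k / 2) * R ^ 2) := by rw [mul_pow]; ring
          _ ≤ _ := by gcongr

lemma eLpNorm_gaborState {k : ℝ} (hk : 0 < k) (z : Lattice d) (μ : Measure (Space d))
    (hμ : μ ≪ volume) : eLpNorm (gaborState hk z) 2 μ = eLpNorm (gaussianState k z) 2 μ :=
  eLpNorm_congr_ae (hμ.ae_le (memLp_gaussianState hk z).coeFn_toLp)

lemma norm_gaborState {k : ℝ} (hk : 0 < k) (z : Lattice d) : ‖gaborState hk z‖ = 1 := by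
  have h1 := eLpNorm_gaussianState_sq hk z
  rw [← eLpNorm_gaborState hk z _ Measure.AbsolutelyContinuous.rfl, ← Lp.enorm_def] at h1
  have h2 := congrArg ENNReal.toReal h1
  rw [ENNReal.toReal_pow, toReal_enorm, ENNReal.toReal_one] at h2
  exact (pow_eq_one_iff_of_nonneg (norm_nonneg _) two_ne_zero).1 h2

lemma norm_dualState_le {k : ℝ} (hk : 0 < k) (z : Lattice d) : ‖dualState hk z‖ ≤ 10 ^ d := by
  have hF := isFrame_gaborState (d := d) hk
  have h1 : frameOperator hk (dualState hk z) = gaborState hk z :=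
    Function.invFun_eq (hF.bijective.2 (gaborState hk z))
  have h2 := hF.norm_le (dualState hk z)
  have h3 : ‖frameOperator hk (dualState hk z)‖ = 1 := by rw [h1, norm_gaborState]
  have h4 : (1 / 10 : ℝ) ^ d * ‖dualState hk z‖ ≤ 1 := h2.trans h3.le
  rwa [one_div, inv_pow, inv_mul_le_one₀ (by positivity)] at h4

/-- The spacing `√(π/k)` exceeds `1/√k`, so each of the `2d` integer coordinates is at most `τ = √k
D` in absolute value and takes at most `2τ + 1 ≤ 3τ` values. -/
lemma card_phaseBall_le {k D : ℝ} (hk : 0 < k) (hD : 0 < D) (h : 1 ≤ Real.sqrt k * D) :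
    ((finite_phaseBall d hk D).toFinset.card : ℝ) ≤ ((3 * (Real.sqrt k * D)) ^ 2) ^ d := by
  set τ := Real.sqrt k * D with hτ
  set N : ℤ := ⌊τ⌋ with hN
  have hN0 : 0 ≤ N := Int.floor_nonneg.2 (by linarith)
  have hs : 0 < Real.sqrt (Real.pi / k) := Real.sqrt_pos.2 (div_pos Real.pi_pos hk)
  have hsk : 1 ≤ Real.sqrt k * Real.sqrt (Real.pi / k) := by
    rw [← Real.sqrt_mul hk.le, mul_div_cancel₀ _ hk.ne']
    exact Real.one_le_sqrt.2 (by linarith [Real.pi_gt_three])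
  have key : ∀ m : Fin d → ℤ, ‖latticePoint k m‖ ≤ D →
      m ∈ Fintype.piFinset fun _ : Fin d => Finset.Icc (-N) N := by
    intro m hm
    rw [Fintype.mem_piFinset]
    intro i
    have h1 : ‖(latticePoint k m) i‖ ≤ D := (PiLp.norm_apply_le (latticePoint k m) i).trans hm
    have h2 : Real.sqrt (Real.pi / k) * |(m i : ℝ)| ≤ D := by
      simpa [latticePoint, abs_mul, abs_of_pos hs] using h1
    have h3 : |(m i : ℝ)| ≤ τ := by
      calc |(m i : ℝ)| ≤ (Real.sqrt k * Real.sqrt (Real.pi / k)) * |(m i : ℝ)| :=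
            le_mul_of_one_le_left (abs_nonneg _) hsk
        _ = Real.sqrt k * (Real.sqrt (Real.pi / k) * |(m i : ℝ)|) := by ring
        _ ≤ τ := by
          rw [hτ]
          gcongr
    have h4 : |m i| ≤ N := by
      rw [hN, Int.le_floor]
      push_cast
      exact h3
    exact Finset.mem_Icc.2 (abs_le.1 h4)
  have hsub : (finite_phaseBall d hk D).toFinset ⊆
      (Fintype.piFinset fun _ : Fin d => Finset.Icc (-N) N) ×ˢ
        (Fintype.piFinset fun _ : Fin d => Finset.Icc (-N) N) := by
    intro z hz
    have hz' : Real.sqrt (‖latticePoint k z.1‖ ^ 2 + ‖latticePoint k z.2‖ ^ 2) ≤ D := by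
      simpa [phaseBall] using hz
    exact Finset.mem_product.2
      ⟨key _ ((Real.le_sqrt_of_sq_le (by nlinarith [sq_nonneg ‖latticePoint k z.2‖])).trans hz'),
       key _ ((Real.le_sqrt_of_sq_le (by nlinarith [sq_nonneg ‖latticePoint k z.1‖])).trans hz')⟩
  have hcard := Finset.card_le_card hsub
  rw [Finset.card_product, Fintype.card_piFinset_const, Int.card_Icc] at hcard
  have hc : (((N + 1 - -N).toNat : ℕ) : ℝ) ≤ 3 * τ := by
    have h1 : (((N + 1 - -N).toNat : ℕ) : ℝ) = 2 * (N : ℝ) + 1 := by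
      have h2 : (((N + 1 - -N).toNat : ℕ) : ℤ) = 2 * N + 1 := by omega
      exact_mod_cast congrArg (Int.cast : ℤ → ℝ) h2
    rw [h1]
    linarith [Int.floor_le τ]
  calc ((finite_phaseBall d hk D).toFinset.card : ℝ)
      ≤ (((N + 1 - -N).toNat : ℕ) : ℝ) ^ d * (((N + 1 - -N).toNat : ℕ) : ℝ) ^ d := by
        exact_mod_cast hcard
    _ ≤ (3 * τ) ^ d * (3 * τ) ^ d := by gcongr
    _ = ((3 * τ) ^ 2) ^ d := by rw [← mul_pow, sq]

variable {S : Set (Space d)}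

lemma eLpNorm_restrict_add_le (v w : L2 d) :
    eLpNorm (v + w : L2 d) 2 (volume.restrict S) ≤
      eLpNorm v 2 (volume.restrict S) + eLpNorm w 2 (volume.restrict S) := by
  rw [eLpNorm_congr_ae (ae_restrict_of_ae (Lp.coeFn_add v w))]
  exact eLpNorm_add_le (Lp.aestronglyMeasurable v).restrict (Lp.aestronglyMeasurable w).restrict
    (by norm_num)

lemma eLpNorm_restrict_smul (c : ℂ) (v : L2 d) :
    eLpNorm (c • v : L2 d) 2 (volume.restrict S) = ‖c‖ₑ * eLpNorm v 2 (volume.restrict S) := by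
  rw [eLpNorm_congr_ae (ae_restrict_of_ae (Lp.coeFn_smul c v)), eLpNorm_const_smul]

lemma eLpNorm_restrict_sum_le {ι : Type*} (s : Finset ι) (v : ι → L2 d) :
    eLpNorm (∑ i ∈ s, v i : L2 d) 2 (volume.restrict S) ≤
      ∑ i ∈ s, eLpNorm (v i) 2 (volume.restrict S) := by
  classical
  induction s using Finset.induction_on with
  | empty =>
    rw [Finset.sum_empty, Finset.sum_empty,
      eLpNorm_congr_ae (ae_restrict_of_ae (Lp.coeFn_zero ℂ 2 volume)), eLpNorm_zero]
  | insert i s hi ih =>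
    rw [Finset.sum_insert hi, Finset.sum_insert hi]
    exact (eLpNorm_restrict_add_le _ _).trans (by gcongr)

/-- The projection `Π_D u` of a unit vector is small far from the ball of radius `D`. -/
lemma eLpNorm_gaborProj_restrict_le {k D : ℝ} (hk : 0 < k) (hD : 0 < D) (h : 1 ≤ Real.sqrt k * D)
    {u : L2 d} (hu : ‖u‖ ≤ 1) :
    eLpNorm (gaborProj hk D u) 2 (volume.restrict {x : Space d | 3 * D ≤ ‖x‖}) ≤
      ENNReal.ofReal ((180 * (Real.sqrt k * D) ^ 2) ^ d * Real.exp (-(Real.sqrt k * D) ^ 2)) := by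
  have hS : MeasurableSet {x : Space d | 3 * D ≤ ‖x‖} :=
    measurableSet_le measurable_const measurable_norm
  set τ := Real.sqrt k * D with hτ
  have hτ2 : τ ^ 2 = k * D ^ 2 := by rw [hτ, mul_pow, Real.sq_sqrt hk.le]
  have hterm : ∀ z ∈ (finite_phaseBall d hk D).toFinset,
      eLpNorm ((inner ℂ (dualState hk z) u : ℂ) • gaborState hk z : L2 d) 2
        (volume.restrict {x : Space d | 3 * D ≤ ‖x‖}) ≤
      ENNReal.ofReal (10 ^ d * (2 ^ d * Real.exp (-τ ^ 2))) := by
    intro z hz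
    have hz' : Real.sqrt (‖latticePoint k z.1‖ ^ 2 + ‖latticePoint k z.2‖ ^ 2) ≤ D := by
      simpa [phaseBall] using hz
    have hz1 : ‖latticePoint k z.1‖ ≤ D :=
      (Real.le_sqrt_of_sq_le (by nlinarith [sq_nonneg ‖latticePoint k z.2‖])).trans hz'
    rw [eLpNorm_restrict_smul, ENNReal.ofReal_mul (by positivity)]
    refine mul_le_mul' ?_ ?_
    · rw [← ofReal_norm]
      refine ENNReal.ofReal_le_ofReal ((norm_inner_le_norm _ _).trans ?_)
      calc ‖dualState hk z‖ * ‖u‖ ≤ 10 ^ d * 1 :=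
            mul_le_mul (norm_dualState_le hk z) hu (norm_nonneg _) (by positivity)
        _ = 10 ^ d := mul_one _
    · rw [eLpNorm_gaborState hk z _ Measure.restrict_le_self.absolutelyContinuous]
      -- Centres in the `D`-ball are at distance at least `2D` from the region. The squared tail
      -- `exp(-2kD²)` is the square of `exp(-τ²)`.
      have h1 := eLpNorm_gaussianState_restrict_sq_le hk (R := 2 * D) (by linarith) z hS
        (fun x hx => by
          have hx' : 3 * D ≤ ‖x‖ := hx
          have := norm_sub_norm_le x (latticePoint k z.1)
          linarith)
      refine (ENNReal.pow_le_pow_left_iff two_ne_zero).1 (h1.trans ?_)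
      rw [← ENNReal.ofReal_pow (by positivity)]
      refine ENNReal.ofReal_le_ofReal ?_
      rw [mul_pow (2 ^ d : ℝ), ← Real.exp_nat_mul]
      refine mul_le_mul (le_self_pow₀ (one_le_pow₀ one_le_two) two_ne_zero) (le_of_eq ?_)
        (Real.exp_pos _).le (by positivity)
      rw [hτ2]
      congr 1
      push_cast
      ring
  unfold gaborProj
  refine (eLpNorm_restrict_sum_le _ _).trans ((Finset.sum_le_card_nsmul _ _ _ hterm).trans ?_)
  rw [nsmul_eq_mul, ← ENNReal.ofReal_natCast, ← ENNReal.ofReal_mul (by positivity)]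
  refine ENNReal.ofReal_le_ofReal ?_
  calc ((finite_phaseBall d hk D).toFinset.card : ℝ) * (10 ^ d * (2 ^ d * Real.exp (-τ ^ 2)))
      ≤ ((3 * τ) ^ 2) ^ d * (10 ^ d * (2 ^ d * Real.exp (-τ ^ 2))) := by
        gcongr
        exact card_phaseBall_le hk hD h
    -- `180 = 3² · 10 · 2`: the count, the dual states and the Gaussian tail.
    _ = (180 * τ ^ 2) ^ d * Real.exp (-τ ^ 2) := by
        rw [← mul_assoc, ← mul_assoc, ← mul_pow, ← mul_pow]
        ring_nf

lemma latticePoint_single {k : ℝ} (i : Fin d) (n : ℤ) :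
    ‖latticePoint k (Pi.single i n)‖ = Real.sqrt (Real.pi / k) * |(n : ℝ)| := by
  have h : latticePoint k (Pi.single i n) =
      PiLp.single 2 i (Real.sqrt (Real.pi / k) * (n : ℝ)) := by
    ext j
    rcases eq_or_ne j i with rfl | hj
    · simp [latticePoint]
    · simp [latticePoint, hj]
  rw [h, PiLp.norm_single, Real.norm_eq_abs, abs_mul,
    abs_of_nonneg (Real.sqrt_nonneg _)]

/-- The norm is `2√π ⌈τ⌉/√k` with `τ = √k D`; use `7/4 ≤ √π ≤ 2` and, as `τ ≥ 1`, `τ ≤ ⌈τ⌉ ≤ 2τ`. -/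
lemma norm_latticePoint_farIndex (hd : 0 < d) {k D : ℝ} (hk : 1 ≤ k) (hD : 1 ≤ D) :
    7 / 2 * D ≤ ‖latticePoint k (farIndex hd k D).1‖ ∧
      ‖latticePoint k (farIndex hd k D).1‖ ≤ 8 * D := by
  have hk0 : 0 < k := zero_lt_one.trans_le hk
  have hs1 : 1 ≤ Real.sqrt k := Real.one_le_sqrt.2 hk
  have hπ1 : 7 / 4 ≤ Real.sqrt Real.pi :=
    Real.le_sqrt_of_sq_le (by linarith [Real.pi_gt_three, Real.pi_gt_d2])
  have hπ2 : Real.sqrt Real.pi ≤ 2 := by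
    rw [Real.sqrt_le_left (by norm_num)]
    linarith [Real.pi_le_four]
  have h0 : 0 ≤ Real.sqrt k * D := by positivity
  have h1 := Int.le_ceil (Real.sqrt k * D)
  have h2 := (Int.ceil_lt_add_one (Real.sqrt k * D)).le
  have heq : ‖latticePoint k (farIndex hd k D).1‖ =
      Real.sqrt Real.pi * (2 * ((⌈Real.sqrt k * D⌉ : ℝ) / Real.sqrt k)) := by
    rw [farIndex, latticePoint_single, Real.sqrt_div Real.pi_pos.le]
    push_cast
    rw [abs_of_nonneg (by linarith)]
    ring
  have h3 : D ≤ (⌈Real.sqrt k * D⌉ : ℝ) / Real.sqrt k := by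
    rw [le_div_iff₀ (by linarith)]
    linarith
  have h4 : (⌈Real.sqrt k * D⌉ : ℝ) / Real.sqrt k ≤ 2 * D := by
    rw [div_le_iff₀ (by linarith)]
    nlinarith
  rw [heq]
  constructor <;> nlinarith

/-- The centre is at distance at least `7D/2 - 3D = D/2` from the ball `‖x‖ < 3D`, so at most `3/4`
of the unit mass lies in that ball. -/
lemma half_le_eLpNorm_farIndex (hd : 0 < d) {k D : ℝ} (hk : 1 ≤ k) (hD : 1 ≤ D)
    (h : 2 ^ d * Real.exp (-(Real.sqrt k * D) ^ 2 / 8) ≤ 3 / 4) :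
    ENNReal.ofReal (1 / 2) ≤
      eLpNorm (gaborState (zero_lt_one.trans_le hk) (farIndex hd k D)) 2
        (volume.restrict {x : Space d | 3 * D ≤ ‖x‖}) := by
  have hk0 : 0 < k := zero_lt_one.trans_le hk
  have hS : MeasurableSet {x : Space d | 3 * D ≤ ‖x‖} :=
    measurableSet_le measurable_const measurable_norm
  rw [eLpNorm_gaborState hk0 _ _ Measure.restrict_le_self.absolutelyContinuous]
  set g := gaussianState (d := d) k (farIndex hd k D)
  have h1 := eLpNorm_gaussianState_sq hk0 (farIndex hd k D)
  have h2 := eLpNorm_gaussianState_restrict_sq_le hk0 (R := D / 2) (by linarith)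
    (farIndex hd k D) hS.compl (fun x hx => by
      have hx' : ‖x‖ < 3 * D := not_le.1 hx
      have h3 := norm_sub_norm_le (latticePoint k (farIndex hd k D).1) x
      rw [norm_sub_rev] at h3
      have := (norm_latticePoint_farIndex hd hk hD).1
      linarith)
  rw [eLpNorm_two_sq, ← lintegral_add_compl _ hS, ← eLpNorm_two_sq, ← eLpNorm_two_sq] at h1
  have h3 : eLpNorm g 2 (volume.restrict {x : Space d | 3 * D ≤ ‖x‖}ᶜ) ^ 2 ≤
      ENNReal.ofReal (3 / 4) := by
    refine h2.trans (ENNReal.ofReal_le_ofReal (le_trans (le_of_eq ?_) h))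
    congr 2
    rw [mul_pow, Real.sq_sqrt hk0.le]
    ring_nf
  refine (ENNReal.pow_le_pow_left_iff two_ne_zero).1 ?_
  rw [← ENNReal.ofReal_pow (by norm_num)]
  refine (ENNReal.add_le_add_iff_right (a := ENNReal.ofReal (3 / 4)) ENNReal.ofReal_ne_top).1 ?_
  rw [← ENNReal.ofReal_add (by norm_num) (by norm_num)]
  calc ENNReal.ofReal ((1 / 2) ^ 2 + 3 / 4) = 1 := by norm_num
    _ ≤ _ := by
      rw [← h1]
      gcongr

lemma exists_threshold (d : ℕ) : ∃ T : ℝ, 1 ≤ T ∧ ∀ τ, T ≤ τ →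
    (180 * τ ^ 2) ^ d * Real.exp (-τ ^ 2) ≤ 1 / 4 ∧
      2 ^ d * Real.exp (-τ ^ 2 / 8) ≤ 3 / 4 := by
  have h1 : Filter.Tendsto (fun y : ℝ => 180 ^ d * (y ^ d * Real.exp (-y))) Filter.atTop
      (nhds (180 ^ d * 0)) :=
    (Real.tendsto_pow_mul_exp_neg_atTop_nhds_zero d).const_mul _
  have h2 : Filter.Tendsto (fun y : ℝ => (2 : ℝ) ^ d * Real.exp (-(y / 8))) Filter.atTop
      (nhds (2 ^ d * 0)) :=
    (Real.tendsto_exp_neg_atTop_nhds_zero.comp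
      (Filter.tendsto_id.atTop_div_const (by norm_num))).const_mul _
  rw [mul_zero] at h1 h2
  obtain ⟨Y, hY⟩ := Filter.eventually_atTop.1
    ((h1.eventually (ge_mem_nhds (show (0 : ℝ) < 1 / 4 by norm_num))).and
      (h2.eventually (ge_mem_nhds (show (0 : ℝ) < 3 / 4 by norm_num))))
  refine ⟨max 1 Y, le_max_left _ _, fun τ hτ => ?_⟩
  have hτ1 : 1 ≤ τ := (le_max_left _ _).trans hτ
  have hτY : Y ≤ τ ^ 2 := by
    have := (le_max_right 1 Y).trans hτ
    nlinarith
  obtain ⟨h3, h4⟩ := hY _ hτY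
  constructor
  · rw [mul_pow, mul_assoc]
    exact h3
  · rw [neg_div]
    exact h4

end Localization

end GaborApprox

/-! ### The sharp estimate -/

theorem mainTheorem5 (d : ℕ) (hd : 0 < d) (p r : ℕ) :
    ∃ C : ℝ, 0 < C ∧ ∃ Dstar : ℝ, 0 < Dstar ∧
      ∀ (k : ℝ) (hk : 1 ≤ k),
        -- the frame operator is well defined and invertible, so that the dual frame makes sense
        ((∀ u : GaborApprox.L2 d, Summable fun z : GaborApprox.Lattice d =>
            (inner ℂ (GaborApprox.gaborState (zero_lt_one.trans_le hk) z) u : ℂ) •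
              GaborApprox.gaborState (zero_lt_one.trans_le hk) z) ∧
          Function.Bijective
            (GaborApprox.frameOperator (d := d) (zero_lt_one.trans_le hk))) ∧
        ∀ D : ℝ, Dstar ≤ D →
          -- the witness, a single Gaussian state
          (∃ u : GaborApprox.L2 d,
            u = GaborApprox.gaborState (zero_lt_one.trans_le hk)
              (GaborApprox.farIndex hd k D) ∧
            u ≠ 0 ∧
            u ∈ GaborApprox.HatSobolev d (p + r) k ∧
            u - GaborApprox.gaborProj (zero_lt_one.trans_le hk) D u ∈
              GaborApprox.HatSobolev d p k ∧
            C * (D ^ r)⁻¹ * GaborApprox.hatNorm (p + r) k u ≤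
              GaborApprox.hatNorm p k
                (u - GaborApprox.gaborProj (zero_lt_one.trans_le hk) D u)) ∧
          -- no constant below `C * D ^ (-r)` is admissible in the approximation estimate
          (∀ ε : ℝ,
            (∀ v ∈ GaborApprox.HatSobolev d (p + r) k,
              GaborApprox.hatNorm p k
                  (v - GaborApprox.gaborProj (zero_lt_one.trans_le hk) D v) ≤
                ε * GaborApprox.hatNorm (p + r) k v) →
            C * (D ^ r)⁻¹ ≤ ε) := by
  open GaborApprox in
  obtain ⟨K, hK, hKle⟩ := exists_hatNorm_gaborState_le d (p + r)
  obtain ⟨T, hT, hTle⟩ := exists_threshold d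
  -- The constant is the lower bound `D^p / 4` over the upper bound `K (8D)^{p+r}`, without the
  -- powers of `D`. Since `√k ≥ 1`, `D ≥ T` already forces `√k D ≥ T`.
  refine ⟨1 / (4 * K * 8 ^ (p + r)), by positivity, T, by linarith, fun k hk => ?_⟩
  have hk0 : 0 < k := zero_lt_one.trans_le hk
  have hF := isFrame_gaborState (d := d) hk0
  refine ⟨⟨fun u => (hF.hasSum u).summable, hF.bijective⟩, fun D hD => ?_⟩
  have hD1 : 1 ≤ D := hT.trans hD
  have hD0 : 0 < D := by linarith
  have hs1 : 1 ≤ Real.sqrt k := Real.one_le_sqrt.2 hk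
  have hτ : T ≤ Real.sqrt k * D := by nlinarith
  obtain ⟨hsmall, hmass⟩ := hTle _ hτ
  set u : L2 d := gaborState hk0 (farIndex hd k D) with hu
  obtain ⟨φ, hφ⟩ : ∃ φ : 𝓢(Space d, ℂ), u = φ.toLp 2 volume := by
    obtain ⟨φ, hφ⟩ := gaussianState_eq_schwartz hk0 (farIndex hd k D)
    exact ⟨φ, gaborState_eq_toLp hk0 _ hφ⟩
  obtain ⟨ψ, hψ⟩ : ∃ ψ : 𝓢(Space d, ℂ), u - gaborProj hk0 D u = ψ.toLp 2 volume := by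
    choose θ hθ using fun z => gaussianState_eq_schwartz (d := d) hk0 z
    refine ⟨φ - ∑ z ∈ (finite_phaseBall d hk0 D).toFinset,
      (inner ℂ (dualState hk0 z) u : ℂ) • θ z, ?_⟩
    have hL : ∀ χ : 𝓢(Space d, ℂ), χ.toLp 2 (volume : Measure (Space d)) =
        SchwartzMap.toLpCLM ℂ ℂ 2 (volume : Measure (Space d)) χ := fun _ => rfl
    rw [hL, map_sub, map_sum, ← hL, ← hφ, gaborProj]
    congr 1
    refine Finset.sum_congr rfl fun z _ => ?_
    rw [map_smul, ← hL, ← gaborState_eq_toLp hk0 z (hθ z)]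
  -- On `‖x‖ ≥ 3D` the error has L² norm at least `1/2 - 1/4`.
  have hlow : (3 * D) ^ p * (1 / 4) ≤ hatNorm p k (u - gaborProj hk0 D u) := by
    refine le_hatNorm (by rw [hψ]; exact hatNormSq_toLp_lt_top p k ψ) (by linarith)
      (by norm_num) ?_
    have h1 := half_le_eLpNorm_farIndex hd hk hD1 hmass
    have h2 := (eLpNorm_gaborProj_restrict_le hk0 hD0 (hT.trans hτ) (u := u)
      (norm_gaborState hk0 _).le).trans (ENNReal.ofReal_le_ofReal hsmall)
    have h3 := eLpNorm_restrict_add_le (S := {x : Space d | 3 * D ≤ ‖x‖})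
      (u - gaborProj hk0 D u) (gaborProj hk0 D u)
    rw [sub_add_cancel] at h3
    refine (ENNReal.add_le_add_iff_right (a := ENNReal.ofReal (1 / 4))
      ENNReal.ofReal_ne_top).1 ?_
    rw [← ENNReal.ofReal_add (by norm_num) (by norm_num)]
    calc ENNReal.ofReal (1 / 4 + 1 / 4) = ENNReal.ofReal (1 / 2) := by norm_num
      _ ≤ _ := h1
      _ ≤ _ := h3
      _ ≤ _ := by gcongr
  have hupp : hatNorm (p + r) k u ≤ K * (8 * D) ^ (p + r) :=
    hKle k hk (8 * D) (farIndex hd k D).1 (by linarith) (norm_latticePoint_farIndex hd hk hD1).2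
  have hmain : 1 / (4 * K * 8 ^ (p + r)) * (D ^ r)⁻¹ * hatNorm (p + r) k u ≤
      hatNorm p k (u - gaborProj hk0 D u) := by
    calc 1 / (4 * K * 8 ^ (p + r)) * (D ^ r)⁻¹ * hatNorm (p + r) k u
        ≤ 1 / (4 * K * 8 ^ (p + r)) * (D ^ r)⁻¹ * (K * (8 * D) ^ (p + r)) := by gcongr
      _ = D ^ p * (1 / 4) := by
          rw [mul_pow, pow_add D]
          field_simp
      _ ≤ (3 * D) ^ p * (1 / 4) := by
          gcongr
          linarith
      _ ≤ _ := hlow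
  -- Strict positivity allows this norm to be cancelled when bounding `ε` below.
  have hpos : 0 < hatNorm (p + r) k u := by
    have h1 := le_hatNorm (p := p + r) (k := k) (w := u) (R := 3 * D) (t := 1 / 2)
      (by rw [hφ]; exact hatNormSq_toLp_lt_top (p + r) k φ) (by linarith) (by norm_num)
      (half_le_eLpNorm_farIndex hd hk hD1 hmass)
    exact lt_of_lt_of_le (by positivity) h1
  have hmem : u ∈ HatSobolev d (p + r) k := by
    rw [hφ]
    exact toLp_mem_hatSobolev (p + r) k φ
  refine ⟨⟨u, rfl, ?_, hmem, ?_, hmain⟩, fun ε hε => ?_⟩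
  · rw [← norm_ne_zero_iff, norm_gaborState]
    exact one_ne_zero
  · rw [hψ]
    exact toLp_mem_hatSobolev p k ψ
  · exact le_of_mul_le_mul_right (hmain.trans (hε u hmem)) hpos
end
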